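/- Let $r\ge 3$ be an integer. For a positive integer $n$ let $t_r(n)$ be the number of edges of the complete balanced $(r-1)$-partite graph on $n$ vertices. An $r$-uniform hypergraph $\mathcal F=(V,\mathcal E)$ with $|V|=n$ is called \emph{Tur\'annical} if for every graph $G=(V,E)$ with more than $t_r(n)$ edges some hyperedge $F\in\mathcal E$ induces a copy of $K_r$ in $G$. For $p\in[0,1]$ let $\mathcal R^{(r)}(n,p)$ be the random $r$-uniform hypergraph on the vertex set $\{1,\dots,n\}$ in which each $r$-element subset is a hyperedge independently with probability $p$. (i) For $r=3$ and every constant $p\in[0,1]$, \[ \lim_{n\to\infty}\mathbb P\big(\mathcal R^{(3)}(n,p)\text{ is Tur\'annical}\big)= \begin{cases}0,&\text{if }p\le 1/2,\\ 1,&\text{if }p>1/2.\end{cases} \] (ii) For every integer $r>3$ there are constants $c=c(r)>0$ and $C=C(r)>0$ such that for every sequence $(p_n)$ of probabilities \[ \lim_{n\to\infty}\mathbb P\big(\mathcal R^{(r)}(n,p_n)\text{ is Tur\'annical}\big)= \begin{cases}0,&\text{if }p_n\le c\,n^{3-r}\text{ for all sufficiently large }n,\\ 1,&\text{if }p_n\ge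 C\,n^{3-r}\text{ for all sufficiently large }n.\end{cases} \] -/

import Mathlib

open Filter Topology MeasureTheory ProbabilityTheory

namespace Turannical

/-- An `r`-uniform hypergraph with vertex set `V`, given by its set of hyperedges,
which is a set of `r`-element subsets of `V`. -/
abbrev UniformHypergraph (r : ℕ) (V : Type*) : Type _ :=
  Set {e : Finset V // e.card = r}

/-- The number `t_r(n)` of edges of the complete balanced `(r - 1)`-partite graph
on `n` vertices. -/
noncomputable def turanNumber (r n : ℕ) : ℕ :=
  (SimpleGraph.turanGraph n (r - 1)).edgeSet.ncard

/-- The hypergraph `F` detects the graph `G` if the vertices of some hyperedge of `F`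
induce a copy of `K_r` in `G`. -/
def Detects {r : ℕ} {V : Type*} (F : UniformHypergraph r V) (G : SimpleGraph V) : Prop :=
  ∃ e ∈ F, G.IsNClique r e.1

/-- `F` is (exactly) Turánnical if it detects every graph on its vertex set with more than
`t_r(n)` edges, where `n` is the number of vertices. -/
def IsTurannical {r : ℕ} {V : Type*} [Fintype V] (F : UniformHypergraph r V) : Prop :=
  ∀ G : SimpleGraph V, turanNumber r (Fintype.card V) < G.edgeSet.ncard → Detects F G

/-- The law of the random `r`-uniform hypergraph on `n` vertices: each `r`-element
subset of the vertex set is a hyperedge independently with probability `p`. -/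
noncomputable def randomHypergraph (r n : ℕ) (p : unitInterval) :
    Measure (UniformHypergraph r (Fin n)) :=
  setBernoulli Set.univ p

/-- The probability that the random `r`-uniform hypergraph on `n` vertices with hyperedge
probability `p` is Turánnical. -/
noncomputable def probTurannical (r n : ℕ) (p : unitInterval) : ℝ :=
  (randomHypergraph r n p).real {F | IsTurannical F}

end Turannical

/-! Failure (the 0-statements). Take a pair `u`, `v` and one further vertex from each hyperedge
through both. If these vertices fit into one class of a Turán graph, add the edge `uv` to that
graph: every `K_r` now uses `uv`, but every hyperedge through `uv` has a third vertex in the class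
of `u`, so nothing is detected (`not_isTurannical_of_card_pairLink`). This needs a pair lying in
fewer than about `n / (r - 1)` hyperedges. For `r > 3` and small `p n^(r-3)`, a Chernoff bound for
one pair suffices. For `r = 3` and `p ≤ 1/2` the mean may sit at the threshold, so one pair works
only with probability bounded away from 0; the `n / 2` pairs of a matching have disjoint links, and
all of them fail with probability at most `(3/4)^(n/2)`.

Success (the 1-statements). The core is a supersaturated stability theorem
(`exists_multipartite_card_symmDiff_le`): a graph with more than `t_r(n)` edges at edit distance `s`
from a suitable complete `(r-1)`-partite graph contains at least `c n^(r-2) s` copies of `K_r`. It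
is therefore undetected with probability at most `exp(-p c n^(r-2) s)`. This beats a union bound
over the `(r-1)^n` colourings and all edit sets as soon as `p n^(r-2) ≥ C n`. For `r = 3` and
constant `p > 1/2` the same bound handles only `s ≥ K` for a large constant `K`. If `s ≤ K`, the
graph is almost bipartite with nearly balanced classes and has an edge `uv` inside a class; `uv`
lies in more than `(1/2 + g) n` hyperedges, so some third vertex is in the other class and untouched
by the edits (`detects_of_card_pairLink`). -/

namespace Turannical

open Finset

/-! ### Supersaturated stability by induction on the number of colours -/

section Supersaturation

open Classical in
/-- The number of ordered `j`-cliques of `G` inside `W`. -/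
noncomputable def orderedCliques {V : Type*} (G : SimpleGraph V) : ℕ → Finset V → ℕ
  | 0, _ => 1
  | j + 1, W => ∑ x ∈ W, orderedCliques G j (W.filter (G.Adj x))

open Classical in
/-- The indicator of adjacency. -/
noncomputable def adjInd {V : Type*} (G : SimpleGraph V) (x y : V) : ℝ :=
  if G.Adj x y then 1 else 0

open Classical in
/-- Twice the indicator of a monochromatic edge, minus the indicator of a bichromatic non-edge. -/
noncomputable def defect {V α : Type*} (G : SimpleGraph V) (χ : V → α) (x y : V) : ℝ :=
  if χ x = χ y then 2 * adjInd G x y else adjInd G x y - 1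

variable {V : Type*} (G : SimpleGraph V)

lemma adjInd_comm (x y : V) : adjInd G x y = adjInd G y x := by
  classical
  unfold adjInd
  exact if_congr (G.adj_comm x y) rfl rfl

lemma adjInd_nonneg (x y : V) : 0 ≤ adjInd G x y := by
  unfold adjInd; split_ifs <;> simp

lemma adjInd_le_one (x y : V) : adjInd G x y ≤ 1 := by
  unfold adjInd; split_ifs <;> simp

open Classical in
lemma sum_adjInd (W : Finset V) (x : V) :
    ∑ y ∈ W, adjInd G x y = #(W.filter (G.Adj x)) := by
  simp [adjInd]

/-- A symmetrisation inequality: low-degree vertices are biased against. -/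
lemma sum_pow_mul_sub_nonpos (W : Finset V) (d : V → ℝ) (hd : ∀ x, 0 ≤ d x) (k : ℕ)
    (f : V → V → ℝ) (hf : ∀ x y, 0 ≤ f x y) (hsymm : ∀ x y, f x y = f y x) :
    ∑ x ∈ W, d x ^ k * ∑ y ∈ W, f x y * (d y - d x) ≤ 0 := by
  have h1 : ∑ x ∈ W, d x ^ k * ∑ y ∈ W, f x y * (d y - d x) =
      ∑ x ∈ W, ∑ y ∈ W, d x ^ k * (f x y * (d y - d x)) := by
    simp_rw [mul_sum]
  have h2 : ∑ x ∈ W, ∑ y ∈ W, d x ^ k * (f x y * (d y - d x)) =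
      ∑ x ∈ W, ∑ y ∈ W, d y ^ k * (f x y * (d x - d y)) := by
    rw [sum_comm]
    refine sum_congr rfl fun x _ => sum_congr rfl fun y _ => by rw [hsymm y x]
  have h3 : ∑ x ∈ W, ∑ y ∈ W, d x ^ k * (f x y * (d y - d x)) +
      ∑ x ∈ W, ∑ y ∈ W, d y ^ k * (f x y * (d x - d y)) ≤ 0 := by
    simp_rw [← sum_add_distrib]
    refine sum_nonpos fun x _ => sum_nonpos fun y _ => ?_
    have : 0 ≤ (d x ^ k - d y ^ k) * (d x - d y) := by
      rcases le_total (d x) (d y) with h | h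
      · exact mul_nonneg_of_nonpos_of_nonpos
          (sub_nonpos.2 (pow_le_pow_left₀ (hd x) h k)) (sub_nonpos.2 h)
      · exact mul_nonneg (sub_nonneg.2 (pow_le_pow_left₀ (hd y) h k)) (sub_nonneg.2 h)
    nlinarith [mul_nonneg (hf x y) this]
  linarith

open Classical in
/-- Extending a colouring of the neighbourhood of `x` by one new colour class. -/
lemma sum_defect_extend (W : Finset V) (x : V) (k : ℕ) (χ : V → Fin (k + 1)) :
    ∑ y ∈ W, ∑ z ∈ W,
      defect G (fun v => if G.Adj x v then (χ v).castSucc else Fin.last (k + 1)) y z =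
    ∑ y ∈ W.filter (G.Adj x), ∑ z ∈ W.filter (G.Adj x), defect G χ y z +
    2 * ∑ y ∈ W, (1 - adjInd G x y) *
      ((#(W.filter (G.Adj y)) : ℝ) - #(W.filter (G.Adj x))) := by
  set χ' : V → Fin (k + 2) := fun v => if G.Adj x v then (χ v).castSucc else Fin.last (k + 1)
  -- A non-neighbour `y` of `x` contributes its adjacencies minus those of `x`; summing over `z`
  -- turns this into a degree difference.
  have hpt : ∀ y z, defect G χ' y z = adjInd G x y * (adjInd G x z * defect G χ y z) +
      (1 - adjInd G x y) * (adjInd G y z - adjInd G x z) +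
      (1 - adjInd G x z) * (adjInd G z y - adjInd G x y) := by
    intro y z
    rw [adjInd_comm G z y]
    by_cases hy : G.Adj x y <;> by_cases hz : G.Adj x z
    · simp [defect, χ', hy, hz, adjInd]
    · have : (χ y).castSucc ≠ Fin.last (k + 1) := (Fin.castSucc_lt_last _).ne
      simp [defect, χ', hy, hz, adjInd, this]
    · have : Fin.last (k + 1) ≠ (χ z).castSucc := (Fin.castSucc_lt_last _).ne'
      simp [defect, χ', hy, hz, adjInd, this]
    · simp [defect, χ', hy, hz, adjInd]; split_ifs <;> norm_num
  simp_rw [hpt, sum_add_distrib]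
  have e1 : ∑ y ∈ W, ∑ z ∈ W, adjInd G x y * (adjInd G x z * defect G χ y z) =
      ∑ y ∈ W.filter (G.Adj x), ∑ z ∈ W.filter (G.Adj x), defect G χ y z := by
    simp_rw [sum_filter, ← mul_sum]
    simp [adjInd, ite_mul]
  have e2 : ∑ y ∈ W, ∑ z ∈ W, (1 - adjInd G x y) * (adjInd G y z - adjInd G x z) =
      ∑ y ∈ W, (1 - adjInd G x y) *
        ((#(W.filter (G.Adj y)) : ℝ) - #(W.filter (G.Adj x))) := by
    simp_rw [← mul_sum, sum_sub_distrib, sum_adjInd]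
  have e3 : ∑ y ∈ W, ∑ z ∈ W, (1 - adjInd G x z) * (adjInd G z y - adjInd G x y) =
      ∑ y ∈ W, (1 - adjInd G x y) *
        ((#(W.filter (G.Adj y)) : ℝ) - #(W.filter (G.Adj x))) := by
    rw [sum_comm, e2]
  rw [e1, e2, e3]; ring

open Classical in
/-- A balanced colouring has nonpositive defect if the graph is sparse. -/
lemma exists_sum_defect_nonpos (W : Finset V) (k : ℕ)
    (h : ∑ x ∈ W, #(W.filter (G.Adj x)) ≤ (#W / 2) * (#W - #W / 2)) :
    ∃ χ : V → Fin (k + 2), ∑ x ∈ W, ∑ y ∈ W, defect G χ x y ≤ 0 := by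
  obtain ⟨S, hSW, hS⟩ := exists_subset_card_eq (Nat.div_le_self #W 2)
  refine ⟨fun v => if v ∈ S then 0 else 1, ?_⟩
  have hpt : ∀ x y, defect G (fun v => if v ∈ S then (0 : Fin (k + 2)) else 1) x y ≤
      2 * adjInd G x y - (if x ∈ S then (1 : ℝ) else 0) * (if y ∈ S then 0 else 1)
        - (if y ∈ S then (1 : ℝ) else 0) * (if x ∈ S then 0 else 1) := by
    intro x y
    have := adjInd_nonneg G x y
    by_cases hx : x ∈ S <;> by_cases hy : y ∈ S <;> simp [defect, hx, hy] <;> linarith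
  refine (sum_le_sum fun x _ => sum_le_sum fun y _ => hpt x y).trans ?_
  have hin : ∑ x ∈ W, (if x ∈ S then (1 : ℝ) else 0) = #S := by
    rw [← sum_filter, filter_mem_eq_inter, inter_eq_right.2 hSW]; simp
  have hout : ∑ x ∈ W, (if x ∈ S then (0 : ℝ) else 1) = #W - #S := by
    have : ∀ x, (if x ∈ S then (0 : ℝ) else 1) = 1 - (if x ∈ S then (1 : ℝ) else 0) := by
      intro x; split_ifs <;> simp
    simp_rw [this, sum_sub_distrib, hin]; simp
  simp_rw [sum_sub_distrib, ← mul_sum, ← sum_mul, hin, hout, ← mul_sum, sum_adjInd]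
  rw [hout]
  have h' : (∑ x ∈ W, (#(W.filter (G.Adj x)) : ℝ)) ≤ #S * (#W - #S) := by
    have : ((∑ x ∈ W, #(W.filter (G.Adj x)) : ℕ) : ℝ) ≤
        (((#W / 2) * (#W - #W / 2) : ℕ) : ℝ) := by exact_mod_cast h
    rw [← hS] at this
    rw [Nat.cast_mul, Nat.cast_sub (card_le_card hSW)] at this
    simpa using this
  linarith

open Classical in
-- For each vertex `x`, colour the neighbourhood of `x` by induction and give all non-neighbours one
-- new colour. Averaging over `x` with weight `d x ^ k` cancels the denominator of the inductive
-- bound, makes the clique counts of the neighbourhoods add up to the next one, and makes the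
-- degree-difference terms nonpositive. Hence some `x` is good.
theorem exists_sum_defect_le (k : ℕ) : ∃ C : ℝ, 0 ≤ C ∧ ∀ {V : Type*} (G : SimpleGraph V)
    (W : Finset V), ∃ χ : V → Fin (k + 1), ∑ x ∈ W, ∑ y ∈ W, defect G χ x y ≤
      C * orderedCliques G (k + 2) W / (#W : ℝ) ^ k := by
  induction k with
  | zero =>
    refine ⟨2, by norm_num, fun G W => ⟨fun _ => 0, ?_⟩⟩
    simp [defect, orderedCliques, ← mul_sum, sum_adjInd]
  | succ k ih =>
    obtain ⟨C, hC, ih⟩ := ih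
    refine ⟨C * 4 ^ k, by positivity, fun {V} G W => ?_⟩
    by_cases hE : ∑ x ∈ W, #(W.filter (G.Adj x)) ≤ (#W / 2) * (#W - #W / 2)
    · obtain ⟨χ, hχ⟩ := exists_sum_defect_nonpos G W k hE
      exact ⟨χ, hχ.trans (by positivity)⟩
    set d : V → ℝ := fun x => #(W.filter (G.Adj x)) with hd
    have hd0 : ∀ x, 0 ≤ d x := fun x => by positivity
    -- The average degree is at least a quarter of `#W`. For odd `#W` the strictness of `hE` makes
    -- up for the rounding.
    have hEm : (#W : ℝ) ^ 2 ≤ 4 * ∑ x ∈ W, d x := by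
      have : #W ^ 2 ≤ 4 * ∑ x ∈ W, #(W.filter (G.Adj x)) := by
        push Not at hE
        obtain ⟨a, ha | ha⟩ := Nat.even_or_odd' #W
        · rw [ha, show 2 * a / 2 = a by omega, show 2 * a - a = a by omega] at hE
          rw [ha]; nlinarith
        · rw [ha, show (2 * a + 1) / 2 = a by omega, show 2 * a + 1 - a = a + 1 by omega] at hE
          rw [ha]; nlinarith
      simp only [hd]; exact_mod_cast this
    have hm : 0 < #W := by
      rcases Nat.eq_zero_or_pos #W with h | h
      · rw [card_eq_zero] at h; subst h; simp at hE
      · exact h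
    have hm' : (0 : ℝ) < #W := by exact_mod_cast hm
    -- Power mean inequality; this lower bound on the total weight is the source of the factor `4 ^
    -- k`.
    have hdk : (#W : ℝ) ^ (k + 1) / 4 ^ k ≤ ∑ x ∈ W, d x ^ k := by
      cases k with
      | zero => simp
      | succ k =>
        refine le_trans ?_ (pow_sum_div_card_le_sum_pow (fun i _ => hd0 i) k)
        rw [div_le_div_iff₀ (by positivity) (by positivity)]
        calc (#W : ℝ) ^ (k + 1 + 1) * (#W : ℝ) ^ k = ((#W : ℝ) ^ 2) ^ (k + 1) := by ring
          _ ≤ (4 * ∑ x ∈ W, d x) ^ (k + 1) := pow_le_pow_left₀ (by positivity) hEm _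
          _ = _ := by ring
    choose χ hχ using fun x => ih G (W.filter (G.Adj x))
    by_contra! hcon
    set K : ℝ := C * 4 ^ k * orderedCliques G (k + 1 + 2) W / (#W : ℝ) ^ (k + 1) with hK
    set Φ : V → ℝ := fun x => ∑ y ∈ W, ∑ z ∈ W,
      defect G (fun v => if G.Adj x v then (χ x v).castSucc else Fin.last (k + 1)) y z with hΦ
    have hΦK : ∀ x, K < Φ x := fun x => hcon _
    have hpos : 0 < ∑ x ∈ W, d x ^ k * (Φ x - K) := by
      refine sum_pos' (fun x _ => mul_nonneg (pow_nonneg (hd0 x) _) (sub_nonneg.2 (hΦK x).le)) ?_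
      obtain ⟨x, hx, hne⟩ := exists_ne_zero_of_sum_ne_zero
        (lt_of_lt_of_le (by positivity) hdk).ne'
      exact ⟨x, hx, mul_pos (lt_of_le_of_ne (pow_nonneg (hd0 x) _) hne.symm)
        (sub_pos.2 (hΦK x))⟩
    have hup : ∑ x ∈ W, d x ^ k * Φ x ≤ C * orderedCliques G (k + 1 + 2) W := by
      have h1 : ∀ x ∈ W, d x ^ k * Φ x ≤ C * orderedCliques G (k + 2) (W.filter (G.Adj x)) +
          2 * (d x ^ k * ∑ y ∈ W, (1 - adjInd G x y) * (d y - d x)) := by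
        intro x _
        simp only [hΦ]
        rw [sum_defect_extend]
        have h2 : d x ^ k * ∑ y ∈ W.filter (G.Adj x), ∑ z ∈ W.filter (G.Adj x),
            defect G (χ x) y z ≤ C * orderedCliques G (k + 2) (W.filter (G.Adj x)) := by
          refine (mul_le_mul_of_nonneg_left (hχ x) (pow_nonneg (hd0 x) k)).trans ?_
          -- If the weight vanishes, the inductive bound is a division by zero, but its left side is
          -- multiplied by zero too.
          rcases (pow_nonneg (hd0 x) k).eq_or_lt with h | h
          · rw [← h, zero_mul]; positivity
          · rw [mul_div_cancel₀ _ h.ne']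
        rw [mul_add]
        refine add_le_add h2 (le_of_eq ?_)
        simp only [hd]; ring
      refine (sum_le_sum h1).trans ?_
      rw [sum_add_distrib, ← mul_sum, ← mul_sum]
      have := sum_pow_mul_sub_nonpos W d hd0 k (fun x y => 1 - adjInd G x y)
        (fun x y => sub_nonneg.2 (adjInd_le_one G x y)) (fun x y => by rw [adjInd_comm])
      rw [show orderedCliques G (k + 1 + 2) W =
        ∑ x ∈ W, orderedCliques G (k + 2) (W.filter (G.Adj x)) from rfl]
      push_cast
      linarith
    have hlow : C * orderedCliques G (k + 1 + 2) W ≤ ∑ x ∈ W, d x ^ k * K := by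
      rw [← sum_mul]
      calc C * orderedCliques G (k + 1 + 2) W = (#W : ℝ) ^ (k + 1) / 4 ^ k * K := by
            rw [hK]; field_simp
        _ ≤ _ := mul_le_mul_of_nonneg_right hdk (by positivity)
    simp_rw [mul_sub, sum_sub_distrib] at hpos
    linarith

end Supersaturation

/-! ### Ordered and unordered cliques -/

section CliqueCount

open Classical in
/-- The cliques of size `j` of `G` inside `W`. -/
noncomputable def cliquesIn {V : Type*} (G : SimpleGraph V) (j : ℕ) (W : Finset V) :
    Finset (Finset V) :=
  (W.powersetCard j).filter fun s => G.IsClique (s : Set V)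

variable {V : Type*} (G : SimpleGraph V)

open Classical in
-- Double counting: a vertex with a clique in its neighbourhood is a larger clique with a marked
-- vertex.
lemma sum_card_cliquesIn_le (j : ℕ) (W : Finset V) :
    ∑ x ∈ W, #(cliquesIn G j (W.filter (G.Adj x))) ≤ (j + 1) * #(cliquesIn G (j + 1) W) := by
  have hR : ∑ s ∈ cliquesIn G (j + 1) W, #s = (j + 1) * #(cliquesIn G (j + 1) W) := by
    rw [sum_const_nat (m := j + 1), mul_comm]
    intro s hs
    simp only [cliquesIn, mem_filter, mem_powersetCard] at hs
    exact hs.1.2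
  have key : ∀ x ∈ W, ∀ s ∈ cliquesIn G j (W.filter (G.Adj x)),
      x ∉ s ∧ insert x s ∈ cliquesIn G (j + 1) W := by
    intro x hx s hs
    simp only [cliquesIn, mem_filter, mem_powersetCard] at hs ⊢
    obtain ⟨⟨hsW, hcard⟩, hcl⟩ := hs
    have hadj : ∀ y ∈ s, G.Adj x y := fun y hy => (mem_filter.1 (hsW hy)).2
    have hxs : x ∉ s := fun h => G.irrefl (hadj x h)
    refine ⟨hxs, ⟨insert_subset hx fun y hy => (mem_filter.1 (hsW hy)).1, ?_⟩, ?_⟩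
    · rw [card_insert_of_notMem hxs, hcard]
    · rw [coe_insert, SimpleGraph.isClique_insert]
      exact ⟨hcl, fun y hy _ => hadj y hy⟩
  rw [← hR, ← card_sigma, ← card_sigma]
  refine card_le_card_of_injOn (fun q => ⟨insert q.1 q.2, q.1⟩) ?_ ?_
  · rintro ⟨x, s⟩ h
    simp only [coe_sigma, Set.mem_sigma_iff, mem_coe] at h ⊢
    exact ⟨(key x h.1 s h.2).2, mem_insert_self _ _⟩
  · rintro ⟨x, s⟩ h ⟨y, t⟩ h' heq
    simp only [coe_sigma, Set.mem_sigma_iff, mem_coe] at h h'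
    simp only [Sigma.mk.injEq, heq_eq_eq] at heq
    obtain ⟨h1, rfl⟩ := heq
    have := congrArg (fun u => u.erase x) h1
    simp only [erase_insert (key x h.1 s h.2).1, erase_insert (key x h'.1 t h'.2).1] at this
    rw [this]

lemma orderedCliques_le (j : ℕ) (W : Finset V) :
    orderedCliques G j W ≤ j.factorial * #(cliquesIn G j W) := by
  classical
  induction j generalizing W with
  | zero =>
    have : (∅ : Finset V) ∈ cliquesIn G 0 W := by simp [cliquesIn]
    simpa [orderedCliques] using card_pos.2 ⟨_, this⟩
  | succ j ih =>
    calc orderedCliques G (j + 1) W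
        ≤ ∑ x ∈ W, j.factorial * #(cliquesIn G j (W.filter (G.Adj x))) :=
          sum_le_sum fun x _ => ih _
      _ = j.factorial * ∑ x ∈ W, #(cliquesIn G j (W.filter (G.Adj x))) := by rw [mul_sum]
      _ ≤ j.factorial * ((j + 1) * #(cliquesIn G (j + 1) W)) :=
          Nat.mul_le_mul_left _ (sum_card_cliquesIn_le G j W)
      _ = _ := by rw [Nat.factorial_succ]; ring

end CliqueCount

/-! ### Cliques versus edit distance from a complete multipartite graph -/

/-- The complete multipartite graph whose parts are the colour classes of `χ`. -/
def multipartite {V α : Type*} (χ : V → α) : SimpleGraph V :=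
  (⊤ : SimpleGraph α).comap χ

@[simp] lemma multipartite_adj {V α : Type*} (χ : V → α) (x y : V) :
    (multipartite χ).Adj x y ↔ χ x ≠ χ y := Iff.rfl

open Classical in
lemma turanNumber_eq (r n : ℕ) :
    turanNumber r n = #(SimpleGraph.turanGraph n (r - 1)).edgeFinset := by
  rw [turanNumber, ← SimpleGraph.coe_edgeFinset, Set.ncard_coe_finset]

open Classical in
-- A graph coloured with `k + 1` colours has no `K_(k+2)`, so Turán's theorem applies.
lemma card_edgeFinset_multipartite_le {n k : ℕ} (χ : Fin n → Fin (k + 1)) :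
    #(multipartite χ).edgeFinset ≤ turanNumber (k + 2) n := by
  rw [turanNumber_eq, show k + 2 - 1 = k + 1 from rfl]
  have h := (SimpleGraph.isTuranMaximal_turanGraph (n := n) (r := k + 1) k.succ_pos).2
    (G' := multipartite χ) (by
      have : (multipartite χ).Colorable (k + 1) := ⟨SimpleGraph.Coloring.mk χ fun h => h⟩
      exact this.cliqueFree (Nat.lt_succ_self _))
  convert h

open Classical in
lemma sum_sum_adjInd {V : Type*} [Fintype V] (G : SimpleGraph V) :
    ∑ x, ∑ y, adjInd G x y = 2 * #G.edgeFinset := by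
  simp_rw [sum_adjInd]
  have := G.sum_degrees_eq_twice_card_edges
  rw [← Nat.cast_two, ← Nat.cast_mul, ← this, Nat.cast_sum]
  refine sum_congr rfl fun x _ => ?_
  rw [← SimpleGraph.card_neighborFinset_eq_degree]
  congr 2
  ext y; simp

lemma defect_eq {V α : Type*} (G : SimpleGraph V) (χ : V → α) (x y : V) :
    defect G χ x y =
      2 * adjInd (G \ multipartite χ) x y - adjInd (multipartite χ \ G) x y := by
  classical
  by_cases h : χ x = χ y <;> by_cases h' : G.Adj x y <;>
    simp [defect, adjInd, h, h']

open Classical in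
/-- A graph with more than `t_r(n)` edges has many copies of `K_r` compared to its distance from
a suitable complete `(r - 1)`-partite graph. -/
theorem exists_multipartite_card_symmDiff_le (k : ℕ) : ∃ c : ℝ, 0 < c ∧
    ∀ (n : ℕ) (G : SimpleGraph (Fin n)), turanNumber (k + 2) n < #G.edgeFinset →
      ∃ χ : Fin n → Fin (k + 1), (∃ u v, G.Adj u v ∧ χ u = χ v) ∧
        c * (n : ℝ) ^ k * #(symmDiff G.edgeFinset (multipartite χ).edgeFinset) ≤
          #(G.cliqueFinset (k + 2)) := by
  obtain ⟨C, hC, H⟩ := exists_sum_defect_le.{0} k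
  -- The factorial passes from ordered to unordered cliques; the `+ 1` keeps the denominator
  -- positive when `C = 0`.
  refine ⟨1 / (C * (k + 2).factorial + 1), by positivity, fun n G hG => ?_⟩
  obtain ⟨χ, hχ⟩ := H G univ
  have hT := card_edgeFinset_multipartite_le χ
  set T := multipartite χ with hTdef
  have hd : ∑ x, ∑ y, defect G χ x y =
      4 * #(G.edgeFinset \ T.edgeFinset) - 2 * #(T.edgeFinset \ G.edgeFinset) := by
    have e : ∀ H H' : SimpleGraph (Fin n),
        ∑ x, ∑ y, adjInd (H \ H') x y = 2 * #(H.edgeFinset \ H'.edgeFinset) := by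
      intro H H'
      rw [sum_sum_adjInd]
      congr 3; ext; simp
    simp_rw [defect_eq, sum_sub_distrib, ← mul_sum, e]
    rw [← hTdef]; ring
  -- `G` has more edges than `T`. This yields a monochromatic edge, and below it gives `4a - 2b ≥ a
  -- + b` for the added edges `a` and the missing edges `b`.
  have hlt : #(T.edgeFinset \ G.edgeFinset) < #(G.edgeFinset \ T.edgeFinset) := by
    have h1 := card_sdiff_add_card_inter G.edgeFinset T.edgeFinset
    have h2 := card_sdiff_add_card_inter T.edgeFinset G.edgeFinset
    rw [inter_comm] at h2
    omega
  refine ⟨χ, ?_, ?_⟩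
  · obtain ⟨e, he⟩ := card_pos.1 (lt_of_le_of_lt (Nat.zero_le _) hlt)
    induction e using Sym2.ind with
    | _ u v =>
      simp only [Finset.mem_sdiff, SimpleGraph.mem_edgeFinset, SimpleGraph.mem_edgeSet] at he
      exact ⟨u, v, he.1, not_not.1 he.2⟩
  have hS : #(symmDiff G.edgeFinset T.edgeFinset) =
      #(G.edgeFinset \ T.edgeFinset) + #(T.edgeFinset \ G.edgeFinset) := by
    rw [symmDiff_def, sup_eq_union, card_union_of_disjoint disjoint_sdiff_sdiff]
  have hcl : cliquesIn G (k + 2) univ = G.cliqueFinset (k + 2) := by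
    ext s; simp [cliquesIn, SimpleGraph.isNClique_iff, and_comm]
  have hN : (orderedCliques G (k + 2) univ : ℝ) ≤
      (k + 2).factorial * #(G.cliqueFinset (k + 2)) := by
    rw [← hcl]; exact_mod_cast orderedCliques_le G (k + 2) univ
  have hn : 0 < (n : ℝ) := by
    rcases Nat.eq_zero_or_pos n with h | h
    · subst h
      have : G.edgeFinset = ∅ := by
        rw [eq_empty_iff_forall_notMem]
        exact fun e => Sym2.ind (fun u => u.elim0) e
      simp [this] at hG
    · exact_mod_cast h
  rw [hd, card_univ, Fintype.card_fin, le_div_iff₀ (by positivity)] at hχ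
  have hlt' : (#(T.edgeFinset \ G.edgeFinset) : ℝ) ≤ #(G.edgeFinset \ T.edgeFinset) := by
    exact_mod_cast hlt.le
  rw [hS, div_mul_eq_mul_div, div_mul_eq_mul_div, div_le_iff₀ (by positivity)]
  push_cast
  have hnk : (0 : ℝ) < (n : ℝ) ^ k := by positivity
  have hcl0 : (0 : ℝ) ≤ #(G.cliqueFinset (k + 2)) := by positivity
  calc 1 * (n : ℝ) ^ k * (#(G.edgeFinset \ T.edgeFinset) + #(T.edgeFinset \ G.edgeFinset))
      ≤ (4 * #(G.edgeFinset \ T.edgeFinset) - 2 * #(T.edgeFinset \ G.edgeFinset)) * (n : ℝ) ^ k := by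
        nlinarith
    _ ≤ C * orderedCliques G (k + 2) univ := hχ
    _ ≤ C * ((k + 2).factorial * #(G.cliqueFinset (k + 2))) := by gcongr
    _ ≤ _ := by nlinarith

/-! ### Finite Bernoulli products: moments, tails and complementation -/

section Bernoulli

/-- The probability of the finite set `F` in the product of `p`-Bernoulli distributions. -/
noncomputable def bernWeight {ι : Type*} [Fintype ι] (p : ℝ) (F : Finset ι) : ℝ :=
  p ^ #F * (1 - p) ^ (Fintype.card ι - #F)

open Classical in
/-- The probability of an event in the product of `p`-Bernoulli distributions. -/
noncomputable def bernProb {ι : Type*} [Fintype ι] (p : ℝ) (P : Finset ι → Prop) : ℝ :=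
  ∑ F with P F, bernWeight p F

variable {ι : Type*} [Fintype ι]

lemma measureReal_setBernoulli_univ (p : unitInterval) (S : Set (Set ι)) :
    (setBernoulli (Set.univ : Set ι) p).real S = bernProb (p : ℝ) fun F : Finset ι => (F : Set ι) ∈ S := by
  classical
  set 𝒮 : Finset (Finset ι) := univ.filter fun F => (F : Set ι) ∈ S with h𝒮
  have hS : S = ⋃ F ∈ 𝒮, {((F : Finset ι) : Set ι)} := by
    ext s
    simp only [h𝒮, mem_filter, mem_univ, true_and, Set.mem_iUnion, Set.mem_singleton_iff, exists_prop]
    refine ⟨fun h => ⟨s.toFinset, by simpa using h, by simp⟩, ?_⟩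
    rintro ⟨F, h, rfl⟩
    exact h
  conv_lhs => rw [hS]
  rw [measureReal_biUnion_finset (by
    intro F _ F' _ h
    simpa [Function.onFun] using h) (by simp)]
  refine sum_congr rfl fun F _ => ?_
  rw [setBernoulli_real_singleton p (Set.subset_univ _) Set.finite_univ, bernWeight,
    Set.ncard_coe_finset, ← Set.compl_eq_univ_sdiff, ← coe_compl, Set.ncard_coe_finset, card_compl]

lemma bernWeight_nonneg {p : ℝ} (h0 : 0 ≤ p) (h1 : p ≤ 1) (F : Finset ι) :
    0 ≤ bernWeight p F :=
  mul_nonneg (pow_nonneg h0 _) (pow_nonneg (sub_nonneg.2 h1) _)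

/-- The generating function of `#(F ∩ A)`: total mass, avoidance probabilities and both Chernoff
bounds are read off from it by choosing `l`. -/
lemma sum_bernWeight_mul_pow [DecidableEq ι] (p l : ℝ) (A : Finset ι) :
    ∑ F, bernWeight p F * l ^ #(F ∩ A) = (1 - p + p * l) ^ #A := by
  have h := prod_add (fun i => p * if i ∈ A then l else 1) (fun _ => 1 - p) (univ : Finset ι)
  have h1 : ∏ i : ι, ((p * if i ∈ A then l else 1) + (1 - p)) = (1 - p + p * l) ^ #A := by
    have : ∀ i, ((p * if i ∈ A then l else 1) + (1 - p)) = if i ∈ A then 1 - p + p * l else 1 := by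
      intro i; split_ifs <;> ring
    simp_rw [this]
    rw [prod_ite_mem, univ_inter, prod_const]
  rw [← h1, h, powerset_univ]
  refine sum_congr rfl fun F _ => ?_
  rw [prod_mul_distrib, prod_const, prod_const, prod_ite_mem, prod_const, bernWeight,
    ← card_compl, ← compl_eq_univ_sdiff]
  ring

lemma sum_bernWeight (p : ℝ) : ∑ F : Finset ι, bernWeight p F = 1 := by
  classical
  simpa using sum_bernWeight_mul_pow p 1 (∅ : Finset ι)

lemma bernProb_nonneg {p : ℝ} (h0 : 0 ≤ p) (h1 : p ≤ 1) (P : Finset ι → Prop) :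
    0 ≤ bernProb p P :=
  sum_nonneg fun F _ => bernWeight_nonneg h0 h1 F

lemma bernProb_mono {p : ℝ} (h0 : 0 ≤ p) (h1 : p ≤ 1) {P Q : Finset ι → Prop}
    (h : ∀ F, P F → Q F) : bernProb p P ≤ bernProb p Q := by
  classical
  exact sum_le_sum_of_subset_of_nonneg (monotone_filter_right _ fun F _ => h F)
    fun F _ _ => bernWeight_nonneg h0 h1 F

lemma bernProb_not (p : ℝ) (P : Finset ι → Prop) :
    bernProb p (fun F => ¬ P F) = 1 - bernProb p P := by
  classical
  rw [← sum_bernWeight (ι := ι) p, eq_sub_iff_add_eq]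
  simp only [bernProb, sum_filter, ← sum_add_distrib]
  refine sum_congr rfl fun F _ => ?_
  by_cases hP : P F <;> simp [hP]

lemma bernProb_and_add (p : ℝ) (P Q : Finset ι → Prop) :
    bernProb p (fun F => P F ∧ Q F) + bernProb p (fun F => P F ∧ ¬ Q F) = bernProb p P := by
  classical
  simp only [bernProb, ← filter_filter]
  exact sum_filter_add_sum_filter_not _ _ _

lemma bernProb_or_le {p : ℝ} (h0 : 0 ≤ p) (h1 : p ≤ 1) (P Q : Finset ι → Prop) :
    bernProb p (fun F => P F ∨ Q F) ≤ bernProb p P + bernProb p Q := by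
  classical
  simp only [bernProb, sum_filter, ← sum_add_distrib]
  refine sum_le_sum fun F _ => ?_
  have := bernWeight_nonneg h0 h1 F
  by_cases hP : P F <;> by_cases hQ : Q F <;> simp [hP, hQ, this]

lemma bernProb_exists_le {p : ℝ} (h0 : 0 ≤ p) (h1 : p ≤ 1) {α : Type*} (s : Finset α)
    (P : α → Finset ι → Prop) :
    bernProb p (fun F => ∃ a ∈ s, P a F) ≤ ∑ a ∈ s, bernProb p (P a) := by
  classical
  induction s using Finset.induction_on with
  | empty => simp [bernProb]
  | insert a s ha ih =>
    rw [sum_insert ha]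
    refine le_trans (bernProb_mono h0 h1 fun F h => ?_)
      ((bernProb_or_le h0 h1 (P a) (fun F => ∃ a ∈ s, P a F)).trans (by linarith))
    simpa using h

open Classical in
lemma bernProb_disjoint (p : ℝ) (A : Finset ι) :
    bernProb p (fun F => Disjoint F A) = (1 - p) ^ #A := by
  have := sum_bernWeight_mul_pow p 0 A
  rw [mul_zero, add_zero] at this
  rw [← this, bernProb, sum_filter]
  refine sum_congr rfl fun F _ => ?_
  rw [disjoint_iff_inter_eq_empty, ← card_eq_zero]
  split_ifs with h <;> simp [h]

lemma bernProb_le_card_inter [DecidableEq ι] {p : ℝ} (h0 : 0 ≤ p) (h1 : p ≤ 1) {l : ℝ} (hl : 1 ≤ l)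
    (A : Finset ι) (a : ℕ) :
    l ^ a * bernProb p (fun F => a ≤ #(F ∩ A)) ≤ (1 - p + p * l) ^ #A := by
  rw [← sum_bernWeight_mul_pow, bernProb, sum_filter, mul_sum]
  refine sum_le_sum fun F _ => ?_
  have := bernWeight_nonneg h0 h1 F
  split_ifs with h
  · rw [mul_comm]
    exact mul_le_mul_of_nonneg_left (pow_le_pow_right₀ hl h) this
  · rw [mul_zero]; positivity

lemma bernProb_card_inter_le [DecidableEq ι] {p : ℝ} (h0 : 0 ≤ p) (h1 : p ≤ 1) {l : ℝ} (hl0 : 0 ≤ l)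
    (hl : l ≤ 1) (A : Finset ι) (a : ℕ) :
    l ^ a * bernProb p (fun F => #(F ∩ A) ≤ a) ≤ (1 - p + p * l) ^ #A := by
  rw [← sum_bernWeight_mul_pow, bernProb, sum_filter, mul_sum]
  refine sum_le_sum fun F _ => ?_
  have := bernWeight_nonneg h0 h1 F
  split_ifs with h
  · rw [mul_comm]
    exact mul_le_mul_of_nonneg_left (pow_le_pow_of_le_one hl0 hl h) this
  · rw [mul_zero]; positivity

/-- For `p ≤ 1 / 2`, resampling `F` on `D` as its complement does not decrease the probability if
`F` contains at least half of `D`. -/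
lemma bernWeight_le_symmDiff [DecidableEq ι] {p : ℝ} (h0 : 0 ≤ p) (h1 : p ≤ 1 / 2) {F D : Finset ι}
    (h : #(D \ F) ≤ #(F ∩ D)) : bernWeight p F ≤ bernWeight p (symmDiff F D) := by
  have e1 : #F = #(F \ D) + #(F ∩ D) := (card_sdiff_add_card_inter F D).symm
  have e2 : #Fᶜ = #(F ∪ D)ᶜ + #(D \ F) := by
    rw [← card_union_of_disjoint]
    · congr 1; ext i; simp; tauto
    · rw [disjoint_left]; intro i; simp; tauto
  have e3 : #(symmDiff F D) = #(F \ D) + #(D \ F) := by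
    rw [symmDiff_def, sup_eq_union, card_union_of_disjoint disjoint_sdiff_sdiff]
  have e4 : #(symmDiff F D)ᶜ = #(F ∪ D)ᶜ + #(F ∩ D) := by
    rw [← card_union_of_disjoint]
    · congr 1; ext i; simp; tauto
    · rw [disjoint_left]; intro i; simp; tauto
  obtain ⟨d, hd⟩ := Nat.exists_eq_add_of_le h
  rw [bernWeight, bernWeight, ← card_compl, ← card_compl, e1, e2, e3, e4, hd]
  have hp : 0 ≤ 1 - p := by linarith
  have : p ^ d ≤ (1 - p) ^ d := pow_le_pow_left₀ h0 (by linarith) d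
  calc p ^ (#(F \ D) + (#(D \ F) + d)) * (1 - p) ^ (#(F ∪ D)ᶜ + #(D \ F))
      = p ^ (#(F \ D) + #(D \ F)) * (1 - p) ^ (#(F ∪ D)ᶜ + #(D \ F)) * p ^ d := by ring
    _ ≤ p ^ (#(F \ D) + #(D \ F)) * (1 - p) ^ (#(F ∪ D)ᶜ + #(D \ F)) * (1 - p) ^ d := by
        gcongr
    _ = _ := by ring

lemma bernProb_le_of_symmDiff [DecidableEq ι] {p : ℝ} (h0 : 0 ≤ p) (h1 : p ≤ 1 / 2) (D : Finset ι)
    {P Q : Finset ι → Prop} (hP : ∀ F, P F → #(D \ F) ≤ #(F ∩ D))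
    (hQ : ∀ F, P F → Q (symmDiff F D)) : bernProb p P ≤ bernProb p Q := by
  classical
  calc bernProb p P ≤ ∑ F with P F, bernWeight p (symmDiff F D) :=
        sum_le_sum fun F hF => bernWeight_le_symmDiff h0 h1 (hP F (mem_filter.1 hF).2)
    _ = ∑ F ∈ (univ.filter P).image (fun F => symmDiff F D), bernWeight p F := by
        rw [sum_image]
        exact fun F _ F' _ h => symmDiff_left_injective D h
    _ ≤ _ := by
        refine sum_le_sum_of_subset_of_nonneg (fun F hF => ?_)
          fun F _ _ => bernWeight_nonneg h0 (by linarith) F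
        obtain ⟨F', hF', rfl⟩ := mem_image.1 hF
        simpa using hQ F' (mem_filter.1 hF').2

/-- Conditioned on an event that does not depend on `A`, the random set contains at least half of
`A` with probability at most `3 / 4`. -/
lemma bernProb_and_half_le [DecidableEq ι] {p : ℝ} (h0 : 0 ≤ p) (h1 : p ≤ 1 / 2) {A : Finset ι}
    (hA : A.Nonempty) {P : Finset ι → Prop}
    (hP : ∀ F D, D ⊆ A → P F → P (symmDiff F D)) :
    bernProb p (fun F => P F ∧ #A ≤ 2 * #(F ∩ A)) ≤ 3 / 4 * bernProb p P := by
  obtain ⟨a, ha⟩ := hA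
  have hp1 : p ≤ 1 := by linarith
  have split1 := bernProb_and_add p P fun F => a ∈ F
  have flip1 : bernProb p (fun F => P F ∧ a ∈ F) ≤ bernProb p (fun F => P F ∧ a ∉ F) := by
    refine bernProb_le_of_symmDiff h0 h1 {a} (fun F hF => ?_) fun F hF => ⟨?_, ?_⟩
    · simp [sdiff_eq_empty_iff_subset.2 (singleton_subset_iff.2 hF.2)]
    · exact hP F _ (singleton_subset_iff.2 ha) hF.1
    · simp [Finset.mem_symmDiff, hF.2]
  have split2 := bernProb_and_add p (fun F => P F ∧ #A ≤ 2 * #(F ∩ A)) fun F => a ∈ F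
  have b1 : bernProb p (fun F => (P F ∧ #A ≤ 2 * #(F ∩ A)) ∧ a ∈ F) ≤
      bernProb p (fun F => P F ∧ a ∈ F) := bernProb_mono h0 hp1 fun F h => ⟨h.1.1, h.2⟩
  have split3 := bernProb_and_add p P fun F => #A ≤ 2 * #(F ∩ A)
  -- Complementing on `A` without `a` leaves strictly less than half of `A`, so ties do no harm.
  -- With `flip1`, the sought probability `x` satisfies `x ≤ P/2 + (P - x)`, where `P` is the
  -- probability of the condition; this is where `3 / 4` comes from.
  have flip2 : bernProb p (fun F => (P F ∧ #A ≤ 2 * #(F ∩ A)) ∧ a ∉ F) ≤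
      bernProb p (fun F => P F ∧ ¬ #A ≤ 2 * #(F ∩ A)) := by
    have key : ∀ F : Finset ι, a ∉ F → #(A.erase a \ F) + #(F ∩ A.erase a) + 1 = #A ∧
        F ∩ A.erase a = F ∩ A := by
      intro F hF
      have h2 : F ∩ A.erase a = F ∩ A := by
        ext i; simp only [mem_inter, mem_erase]
        exact ⟨fun h => ⟨h.1, h.2.2⟩, fun h => ⟨h.1, fun e => hF (e ▸ h.1), h.2⟩⟩
      refine ⟨?_, h2⟩
      rw [inter_comm, card_sdiff_add_card_inter, card_erase_add_one ha]
    refine bernProb_le_of_symmDiff h0 h1 (A.erase a) (fun F hF => ?_) fun F hF => ⟨?_, ?_⟩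
    · obtain ⟨k1, k2⟩ := key F hF.2
      have := hF.1.2
      rw [k2] at k1 ⊢
      omega
    · exact hP F _ (erase_subset _ _) hF.1.1
    · obtain ⟨k1, k2⟩ := key F hF.2
      have : symmDiff F (A.erase a) ∩ A = A.erase a \ F := by
        ext i
        simp only [mem_inter, Finset.mem_symmDiff, mem_erase, Finset.mem_sdiff]
        have := hF.2
        grind
      rw [this]
      have := hF.1.2
      rw [k2] at k1
      omega
  linarith

lemma bernProb_forall_half_le [DecidableEq ι] {p : ℝ} (h0 : 0 ≤ p) (h1 : p ≤ 1 / 2) {j : ℕ}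
    (A : ℕ → Finset ι) (hA : ∀ i < j, (A i).Nonempty)
    (hdisj : ∀ i < j, ∀ i' < j, i ≠ i' → Disjoint (A i) (A i')) :
    bernProb p (fun F => ∀ i < j, #(A i) ≤ 2 * #(F ∩ A i)) ≤ (3 / 4) ^ j := by
  induction j with
  | zero =>
    have := sum_bernWeight (ι := ι) p
    simp [bernProb, this]
  | succ j ih =>
    have ih := ih (fun i hi => hA i (by omega)) fun i hi i' hi' =>
      hdisj i (by omega) i' (by omega)
    have step := bernProb_and_half_le h0 h1 (hA j (Nat.lt_succ_self j))
      (P := fun F => ∀ i < j, #(A i) ≤ 2 * #(F ∩ A i)) (by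
        intro F D hD h i hi
        have hdis := hdisj i (by omega) j (by omega) hi.ne
        have : symmDiff F D ∩ A i = F ∩ A i := by
          ext x
          simp only [mem_inter, Finset.mem_symmDiff]
          have : x ∈ A i → x ∉ D := fun hx hx' => disjoint_left.1 hdis hx (hD hx')
          tauto
        rw [this]; exact h i hi)
    rw [pow_succ]
    refine (bernProb_mono h0 (by linarith) fun F h => ?_).trans
      (step.trans (by linarith))
    exact ⟨fun i hi => h i (by omega), h j (by omega)⟩

end Bernoulli

/-! ### Hyperedges through a pair, and undetected graphs -/

open Classical in
/-- The hyperedges that contain both `u` and `v`. -/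
noncomputable def pairLink {n : ℕ} (r : ℕ) (u v : Fin n) :
    Finset {e : Finset (Fin n) // e.card = r} :=
  univ.filter fun e => u ∈ e.1 ∧ v ∈ e.1

@[simp] lemma mem_pairLink {n r : ℕ} {u v : Fin n} {e : {e : Finset (Fin n) // e.card = r}} :
    e ∈ pairLink r u v ↔ u ∈ e.1 ∧ v ∈ e.1 := by
  simp [pairLink]

lemma card_pairLink {n : ℕ} (k : ℕ) {u v : Fin n} (huv : u ≠ v) :
    #(pairLink (k + 2) u v) = (n - 2).choose k := by
  classical
  have h2 : #({u, v} : Finset (Fin n)) = 2 := card_pair huv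
  have h : (pairLink (k + 2) u v).map ⟨Subtype.val, Subtype.val_injective⟩ =
      (powersetCard k ({u, v} : Finset (Fin n))ᶜ).image fun s => s ∪ {u, v} := by
    ext e
    simp only [Finset.mem_map, mem_pairLink, Function.Embedding.coeFn_mk, Subtype.exists, mem_image,
      mem_powersetCard]
    constructor
    · rintro ⟨e, he, ⟨hu, hv⟩, rfl⟩
      have hsub : ({u, v} : Finset (Fin n)) ⊆ e := by
        intro x hx; rcases mem_insert.1 hx with rfl | hx
        · exact hu
        · rwa [mem_singleton.1 hx]
      refine ⟨e \ {u, v}, ⟨fun x hx => ?_, ?_⟩, sdiff_union_of_subset hsub⟩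
      · exact mem_compl.2 (Finset.mem_sdiff.1 hx).2
      · rw [card_sdiff_of_subset hsub, he, h2]; omega
    · rintro ⟨s, ⟨hs, hcard⟩, rfl⟩
      refine ⟨_, ?_, ⟨by simp, by simp⟩, rfl⟩
      rw [card_union_of_disjoint, hcard, h2]
      exact disjoint_left.2 fun x hx hx' => mem_compl.1 (hs hx) hx'
  have := congrArg card h
  rw [card_map, card_image_of_injOn, card_powersetCard, card_compl, h2, Fintype.card_fin] at this
  · exact this
  · intro s hs t ht hst
    simp only [mem_coe, mem_powersetCard] at hs ht
    have hcancel : ∀ s : Finset (Fin n), s ⊆ ({u, v} : Finset (Fin n))ᶜ →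
        (s ∪ {u, v}) \ {u, v} = s := fun s hs =>
      union_sdiff_cancel_right (disjoint_left.2 fun x hx hx' => mem_compl.1 (hs hx) hx')
    have := congrArg (· \ ({u, v} : Finset (Fin n))) hst
    simpa only [hcancel s hs.1, hcancel t ht.1] using this

/-- Residue `0` is a largest class of the Turán graph, of size `n / (k + 1)` rounded up. -/
lemma card_turan_class {n k : ℕ} :
    (n + k) / (k + 1) ≤ #(univ.filter fun x : Fin n => (x : ℕ) % (k + 1) = 0) := by
  have hlt : ∀ i < (n + k) / (k + 1), (k + 1) * i < n := by
    intro i hi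
    have : (i + 1) * (k + 1) ≤ n + k := (Nat.le_div_iff_mul_le k.succ_pos).1 hi
    nlinarith
  have hsub : (range ((n + k) / (k + 1))).image (fun i => (k + 1) * i) ⊆
      (univ.filter fun x : Fin n => (x : ℕ) % (k + 1) = 0).image Fin.val := by
    intro x hx
    obtain ⟨i, hi, rfl⟩ := mem_image.1 hx
    exact mem_image.2 ⟨⟨_, hlt i (mem_range.1 hi)⟩, by simp, rfl⟩
  have := (card_le_card hsub).trans card_image_le
  rwa [card_image_of_injective _ (mul_right_injective₀ k.succ_ne_zero), card_range] at this

/-- If few hyperedges contain both `u` and `v`, then adding the edge `uv` to a suitable Turán graph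
gives an undetected graph. -/
lemma not_isTurannical_of_card_pairLink {n k : ℕ} (hk : 1 ≤ k) {u v : Fin n} (huv : u ≠ v)
    (F : Finset {e : Finset (Fin n) // e.card = k + 2})
    (hF : #(F ∩ pairLink (k + 2) u v) + 2 ≤ (n + k) / (k + 1)) :
    ¬ IsTurannical (F : UniformHypergraph (k + 2) (Fin n)) := by
  -- A third vertex exists because `k ≥ 1`.
  have hw : ∀ e : {e : Finset (Fin n) // e.card = k + 2}, ∃ w ∈ e.1, w ≠ u ∧ w ≠ v := by
    intro e
    have h : 0 < #(e.1 \ {u, v}) := by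
      have := le_card_sdiff {u, v} e.1
      rw [card_pair huv, e.2] at this
      omega
    obtain ⟨w, hw⟩ := card_pos.1 h
    simp only [Finset.mem_sdiff, mem_insert, mem_singleton, not_or] at hw
    exact ⟨w, hw⟩
  choose w hwe hwu hwv using hw
  set Z := univ.filter fun x : Fin n => (x : ℕ) % (k + 1) = 0
  set Q : Finset (Fin n) := {u, v} ∪ (F ∩ pairLink (k + 2) u v).image w with hQ
  have hQZ : #Q ≤ #Z := by
    refine (card_union_le _ _).trans ?_
    have h1 := card_image_le (s := F ∩ pairLink (k + 2) u v) (f := w)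
    have h2 : (n + k) / (k + 1) ≤ #Z := by convert card_turan_class
    rw [card_pair huv]
    omega
  obtain ⟨Z', hZ', hcard⟩ := exists_subset_card_eq hQZ
  set g : Q ≃ Z' := equivOfCardEq hcard.symm
  -- Relabel the vertices so that all of `Q` lands in the class of residue `0`.
  set s : Equiv.Perm (Fin n) := Equiv.extendSubtype (p := (· ∈ Q)) (q := (· ∈ Z')) g with hs
  have hsQ : ∀ x ∈ Q, (s x : ℕ) % (k + 1) = 0 := fun x hx =>
    (mem_filter.1 (hZ' (Equiv.extendSubtype_mem (p := (· ∈ Q)) (q := (· ∈ Z')) g x hx))).2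
  set T := (SimpleGraph.turanGraph n (k + 1)).comap s with hT
  have hTadj : ∀ x y, T.Adj x y ↔ (s x : ℕ) % (k + 1) ≠ (s y : ℕ) % (k + 1) := fun x y => Iff.rfl
  have hTfree : T.CliqueFree (k + 2) :=
    (SimpleGraph.turanGraph_cliqueFree k.succ_pos).comap ⟨(SimpleGraph.Iso.comap s _).toCopy⟩
  have huQ : u ∈ Q := by simp [hQ]
  have hvQ : v ∈ Q := by simp [hQ]
  have hTuv : ¬ T.Adj u v := by rw [hTadj, hsQ u huQ, hsQ v hvQ]; simp
  have hTcard : T.edgeSet.ncard = turanNumber (k + 2) n :=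
    Set.ncard_congr' (SimpleGraph.Iso.comap s (SimpleGraph.turanGraph n (k + 1))).mapEdgeSet
  intro hF'
  obtain ⟨e, heF, he⟩ := hF' (T ⊔ SimpleGraph.edge u v) (by
    rw [Fintype.card_fin, ← hTcard]
    have hsub : insert s(u, v) T.edgeSet ⊆ (T ⊔ SimpleGraph.edge u v).edgeSet := by
      rintro x (rfl | hx)
      · simp [huv]
      · exact SimpleGraph.edgeSet_mono le_sup_left hx
    have := Set.ncard_le_ncard hsub (Set.toFinite _)
    rw [Set.ncard_insert_of_notMem hTuv (Set.toFinite _)] at this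
    omega)
  by_cases hmem : u ∈ e.1 ∧ v ∈ e.1
  · have hwQ : w e ∈ Q :=
      mem_union_right _ (mem_image_of_mem _ (mem_inter.2 ⟨heF, mem_pairLink.2 hmem⟩))
    have hadj := he.isClique hmem.1 (hwe e) (hwu e).symm
    rw [SimpleGraph.sup_adj, hTadj, hsQ u huQ, hsQ _ hwQ, SimpleGraph.edge_adj] at hadj
    have h1 := hwu e
    have h2 := hwv e
    grind
  · refine hTfree e.1 ⟨fun x hx y hy hxy => ?_, he.card_eq⟩
    have hadj := he.isClique hx hy hxy
    rw [SimpleGraph.sup_adj, SimpleGraph.edge_adj] at hadj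
    rcases hadj with h | ⟨h, -⟩
    · exact h
    · exfalso; apply hmem
      rcases h with ⟨rfl, rfl⟩ | ⟨rfl, rfl⟩
      · exact ⟨hx, hy⟩
      · exact ⟨hy, hx⟩

/-! ### The 0-statements -/

lemma probTurannical_eq (r n : ℕ) (p : unitInterval) :
    probTurannical r n p = bernProb (p : ℝ)
      fun F : Finset {e : Finset (Fin n) // e.card = r} =>
        IsTurannical (F : UniformHypergraph r (Fin n)) :=
  measureReal_setBernoulli_univ p _

lemma pairLink_disjoint {n : ℕ} {u v u' v' : Fin n} (huv : u ≠ v) (huv' : u' ≠ v')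
    (h1 : u ≠ u') (h2 : u ≠ v') (h3 : v ≠ u') (h4 : v ≠ v') :
    Disjoint (pairLink 3 u v) (pairLink 3 u' v') := by
  classical
  rw [disjoint_left]
  intro e he he'
  rw [mem_pairLink] at he he'
  have hsub : ({u, v, u', v'} : Finset (Fin n)) ⊆ e.1 := by
    intro x; simp only [mem_insert, mem_singleton]
    rintro (rfl | rfl | rfl | rfl) <;> simp_all
  have := card_le_card hsub
  rw [e.2, card_insert_of_notMem, card_insert_of_notMem, card_pair huv'] at this <;>
    simp_all

theorem probTurannical_three_le {n : ℕ} (hn : 3 ≤ n) (p : unitInterval) (hp : (p : ℝ) ≤ 1 / 2) :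
    probTurannical 3 n p ≤ (3 / 4) ^ (n / 2) := by
  classical
  rw [probTurannical_eq]
  set A : ℕ → Finset {e : Finset (Fin n) // e.card = 3} := fun i =>
    if h : 2 * i + 1 < n then pairLink 3 ⟨2 * i, by omega⟩ ⟨2 * i + 1, h⟩ else ∅ with hA
  have hAi : ∀ i (h : 2 * i + 1 < n),
      A i = pairLink 3 ⟨2 * i, by omega⟩ ⟨2 * i + 1, h⟩ := fun i h => by simp [hA, h]
  have hcard : ∀ i, 2 * i + 1 < n → #(A i) = n - 2 := fun i h => by
    rw [hAi i h, card_pairLink 1 (by simp), Nat.choose_one_right]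
  refine le_trans (bernProb_mono p.2.1 p.2.2 fun F hF i hi => ?_)
    (bernProb_forall_half_le (j := n / 2) p.2.1 hp A ?_ ?_)
  · have h : 2 * i + 1 < n := by omega
    rw [hcard i h]
    by_contra hlt
    refine not_isTurannical_of_card_pairLink (k := 1) le_rfl
      (u := ⟨2 * i, by omega⟩) (v := ⟨2 * i + 1, h⟩) (by simp) F ?_ hF
    rw [hAi i h] at hlt
    simp only [Nat.reduceAdd]
    -- From `2f < n - 2` one gets `f + 2 ≤ (n + 1) / 2`: fewer than half of the possible hyperedges
    -- is exactly what the construction tolerates.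
    omega
  · intro i hi
    rw [← card_pos, hcard i (by omega)]; omega
  · intro i hi i' hi' hne
    rw [hAi i (by omega), hAi i' (by omega)]
    refine pairLink_disjoint ?_ ?_ ?_ ?_ ?_ ?_ <;> simp only [ne_eq, Fin.mk.injEq] <;> omega

theorem tendsto_probTurannical_three_zero (p : unitInterval) (hp : (p : ℝ) ≤ 1 / 2) :
    Tendsto (fun n : ℕ => probTurannical 3 n p) atTop (𝓝 0) := by
  have h : Tendsto (fun n : ℕ => (3 / 4 : ℝ) ^ (n / 2)) atTop (𝓝 0) :=
    (tendsto_pow_atTop_nhds_zero_of_lt_one (by norm_num) (by norm_num)).comp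
      (Nat.tendsto_div_const_atTop two_ne_zero)
  refine tendsto_of_tendsto_of_tendsto_of_le_of_le' tendsto_const_nhds h
    (Eventually.of_forall fun n => measureReal_nonneg) ?_
  filter_upwards [eventually_ge_atTop 3] with n hn
  exact probTurannical_three_le hn p hp

theorem probTurannical_le_exp {n k : ℕ} (hk : 1 ≤ k) (hn : 2 ≤ n) (p : unitInterval)
    (hp : (p : ℝ) * (n : ℝ) ^ k ≤ n / (4 * (k + 1))) :
    probTurannical (k + 2) n p ≤ 2 * Real.exp (-(n / (4 * (k + 1)))) := by
  classical
  rw [probTurannical_eq]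
  set u : Fin n := ⟨0, by omega⟩
  set v : Fin n := ⟨1, by omega⟩
  have huv : u ≠ v := by simp [u, v]
  set a := (n + k) / (k + 1) - 1 with ha
  have hcard : (#(pairLink (k + 2) u v) : ℝ) ≤ (n : ℝ) ^ k := by
    rw [card_pairLink k huv]
    exact_mod_cast (Nat.choose_le_pow _ _).trans (Nat.pow_le_pow_left (Nat.sub_le n 2) k)
  have hle := bernProb_le_card_inter p.2.1 p.2.2 (l := 2) (by norm_num) (pairLink (k + 2) u v) a
  have hT := bernProb_mono p.2.1 p.2.2 (P := fun F : Finset {e : Finset (Fin n) // e.card = k + 2}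
      => IsTurannical (F : UniformHypergraph (k + 2) (Fin n)))
    (Q := fun F => a ≤ #(F ∩ pairLink (k + 2) u v)) (by
      intro F hF
      by_contra hlt
      exact not_isTurannical_of_card_pairLink hk huv F (by omega) hF)
  refine hT.trans ?_
  have hpn : 0 ≤ (p : ℝ) := p.2.1
  have hup : (1 - (p : ℝ) + p * 2) ^ #(pairLink (k + 2) u v) ≤ Real.exp (n / (4 * (k + 1))) := by
    calc (1 - (p : ℝ) + p * 2) ^ #(pairLink (k + 2) u v)
        ≤ Real.exp p ^ #(pairLink (k + 2) u v) := by
          refine pow_le_pow_left₀ (by linarith) ?_ _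
          linarith [Real.add_one_le_exp (p : ℝ)]
      _ = Real.exp (#(pairLink (k + 2) u v) * p) := (Real.exp_nat_mul _ _).symm
      _ ≤ _ := Real.exp_le_exp.2 (by nlinarith)
  -- The Chernoff gain `2 ^ a` is about `exp` of twice the exponent in `hup`, so half of it
  -- survives; the leading `2` pays for the `- 1` in `a`.
  have hlow : Real.exp (n / (2 * (k + 1))) ≤ 2 * 2 ^ a := by
    have ha' : (n : ℝ) / (k + 1) ≤ (a + 1 : ℕ) := by
      rw [div_le_iff₀ (by positivity)]
      have : n ≤ (a + 1) * (k + 1) := by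
        have h1 : n + k < ((n + k) / (k + 1) + 1) * (k + 1) :=
          Nat.lt_mul_of_div_lt (Nat.lt_succ_self _) k.succ_pos
        have h2 : 1 ≤ (n + k) / (k + 1) := (Nat.one_le_div_iff k.succ_pos).2 (by omega)
        rw [ha, Nat.sub_add_cancel h2]
        nlinarith
      exact_mod_cast this
    have h2 : Real.exp (1 / 2) ≤ 2 := by
      rw [← Real.le_log_iff_exp_le (by norm_num)]
      linarith [Real.log_two_gt_d9]
    calc Real.exp (n / (2 * (k + 1))) ≤ Real.exp ((a + 1 : ℕ) * (1 / 2)) := by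
          refine Real.exp_le_exp.2 ?_
          calc (n : ℝ) / (2 * (k + 1)) = n / (k + 1) * (1 / 2) := by field_simp
            _ ≤ _ := by gcongr
      _ = Real.exp (1 / 2) ^ (a + 1) := Real.exp_nat_mul _ _
      _ ≤ 2 ^ (a + 1) := pow_le_pow_left₀ (Real.exp_pos _).le h2 _
      _ = _ := by ring
  have hsplit : Real.exp (n / (2 * (k + 1))) =
      Real.exp (n / (4 * (k + 1))) * Real.exp (n / (4 * (k + 1))) := by
    rw [← Real.exp_add]; congr 1; field_simp; ring
  have h2a : (0 : ℝ) < 2 ^ a := by positivity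
  have hb := hle.trans hup
  rw [Real.exp_neg, ← div_eq_mul_inv, le_div_iff₀ (Real.exp_pos _)]
  rw [hsplit] at hlow
  set E := Real.exp (n / (4 * (k + 1)))
  have hE : 0 < E := Real.exp_pos _
  set B := bernProb (p : ℝ) (fun F => a ≤ #(F ∩ pairLink (k + 2) u v))
  have hB : 0 ≤ B := bernProb_nonneg p.2.1 p.2.2 _
  have h3 : E * E * B ≤ 2 * E := by
    have := mul_le_mul_of_nonneg_right hlow hB
    linarith
  nlinarith

theorem tendsto_probTurannical_zero (k : ℕ) (hk : 1 ≤ k) (p : ℕ → unitInterval)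
    (hp : ∀ᶠ n : ℕ in atTop, (p n : ℝ) * (n : ℝ) ^ k ≤ n / (4 * (k + 1))) :
    Tendsto (fun n : ℕ => probTurannical (k + 2) n (p n)) atTop (𝓝 0) := by
  have h : Tendsto (fun n : ℕ => 2 * Real.exp (-((n : ℝ) / (4 * (k + 1))))) atTop (𝓝 0) := by
    rw [← mul_zero (2 : ℝ)]
    refine Tendsto.const_mul _ (Real.tendsto_exp_neg_atTop_nhds_zero.comp ?_)
    exact tendsto_natCast_atTop_atTop.atTop_div_const (by positivity)
  refine tendsto_of_tendsto_of_tendsto_of_le_of_le' tendsto_const_nhds h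
    (Eventually.of_forall fun n => measureReal_nonneg) ?_
  filter_upwards [hp, eventually_ge_atTop 2] with n h hn
  exact probTurannical_le_exp hk hn _ h

/-! ### The union bound and the 1-statement above a large constant -/

open Classical in
/-- The `r`-sets of vertices that induce a copy of `K_r` in `G`. -/
noncomputable def cliqueEdges {n : ℕ} (r : ℕ) (G : SimpleGraph (Fin n)) :
    Finset {e : Finset (Fin n) // e.card = r} :=
  univ.filter fun e => G.IsNClique r e.1

open Classical in
lemma card_cliqueEdges {n : ℕ} (r : ℕ) (G : SimpleGraph (Fin n)) :
    #(cliqueEdges r G) = #(G.cliqueFinset r) := by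
  rw [← card_map ⟨Subtype.val, Subtype.val_injective⟩]
  congr 1
  ext s
  simp only [cliqueEdges, Finset.mem_map, mem_filter, mem_univ, true_and,
    Function.Embedding.coeFn_mk, Subtype.exists, exists_and_left, exists_prop,
    SimpleGraph.mem_cliqueFinset_iff]
  exact ⟨fun ⟨t, ht, _, e⟩ => e ▸ ht, fun h => ⟨s, h, h.card_eq, rfl⟩⟩

lemma disjoint_cliqueEdges {n r : ℕ} {G : SimpleGraph (Fin n)}
    {F : Finset {e : Finset (Fin n) // e.card = r}}
    (h : ¬ Detects (F : UniformHypergraph r (Fin n)) G) : Disjoint F (cliqueEdges r G) := by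
  rw [disjoint_left]
  intro e he he'
  exact h ⟨e, he, by simpa [cliqueEdges] using he'⟩

/-- The graph that differs from the complete multipartite graph of `χ` exactly in `S`. -/
def perturb {V α : Type*} (χ : V → α) (S : Set (Sym2 V)) : SimpleGraph V :=
  SimpleGraph.fromEdgeSet (symmDiff S (multipartite χ).edgeSet)

open Classical in
lemma perturb_symmDiff {n : ℕ} {α : Type*} (χ : Fin n → α) (G : SimpleGraph (Fin n)) :
    perturb χ (symmDiff G.edgeFinset (multipartite χ).edgeFinset : Finset (Sym2 (Fin n))) = G := by
  rw [perturb, coe_symmDiff, SimpleGraph.coe_edgeFinset, SimpleGraph.coe_edgeFinset,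
    symmDiff_symmDiff_cancel_right, SimpleGraph.fromEdgeSet_edgeSet]

open Classical in
/-- The union bound over all graphs of edit distance at least `K` from being complete
`(k + 1)`-partite with many cliques relative to this distance. -/
lemma bernProb_exists_not_detects_le {n k K : ℕ} (hn : 1 ≤ n) {p c x : ℝ} (h0 : 0 ≤ p)
    (h1 : p ≤ 1) (hx0 : 0 ≤ x) (hx : 2 * x ≤ p * (c * (n : ℝ) ^ k))
    (hxn : (n : ℝ) ^ 2 * Real.exp (-x) ≤ 1) :
    bernProb p (fun F : Finset {e : Finset (Fin n) // e.card = k + 2} =>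
      ∃ (G : SimpleGraph (Fin n)) (χ : Fin n → Fin (k + 1)),
        c * (n : ℝ) ^ k * #(symmDiff G.edgeFinset (multipartite χ).edgeFinset) ≤
          #(G.cliqueFinset (k + 2)) ∧
        K ≤ #(symmDiff G.edgeFinset (multipartite χ).edgeFinset) ∧
        ¬ Detects (F : UniformHypergraph (k + 2) (Fin n)) G) ≤
      (k + 1 : ℝ) ^ n * Real.exp (1 - x * K) := by
  set I := (univ : Finset ((Fin n → Fin (k + 1)) × Finset (Sym2 (Fin n)))).filter fun q =>
    c * (n : ℝ) ^ k * #q.2 ≤ #((perturb q.1 q.2).cliqueFinset (k + 2)) ∧ K ≤ #q.2 with hI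
  have hcover : ∀ F : Finset {e : Finset (Fin n) // e.card = k + 2},
      (∃ (G : SimpleGraph (Fin n)) (χ : Fin n → Fin (k + 1)),
        c * (n : ℝ) ^ k * #(symmDiff G.edgeFinset (multipartite χ).edgeFinset) ≤
          #(G.cliqueFinset (k + 2)) ∧
        K ≤ #(symmDiff G.edgeFinset (multipartite χ).edgeFinset) ∧
        ¬ Detects (F : UniformHypergraph (k + 2) (Fin n)) G) →
      ∃ q ∈ I, Disjoint F (cliqueEdges (k + 2) (perturb q.1 q.2)) := by
    rintro F ⟨G, χ, hc, hK, hF⟩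
    have hG := perturb_symmDiff χ G
    set S := symmDiff G.edgeFinset (multipartite χ).edgeFinset
    refine ⟨(χ, S), mem_filter.2 ⟨mem_univ _, ?_, hK⟩, ?_⟩
    · simp only [hG]; exact hc
    · simp only [hG]; exact disjoint_cliqueEdges hF
  refine (bernProb_mono h0 h1 hcover).trans ((bernProb_exists_le h0 h1 I _).trans ?_)
  -- The exponent is at least `2 * x * #q.2`: one half gives `x * K`, the other makes the sum over
  -- edit sets converge to at most `e`.
  have hterm : ∀ q ∈ I, bernProb p (fun F => Disjoint F (cliqueEdges (k + 2) (perturb q.1 q.2))) ≤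
      Real.exp (-(x * K)) * Real.exp (-x) ^ #q.2 := by
    intro q hq
    obtain ⟨hc, hK⟩ := (mem_filter.1 hq).2
    rw [bernProb_disjoint, card_cliqueEdges]
    have hK' : (K : ℝ) ≤ #q.2 := by exact_mod_cast hK
    calc (1 - p) ^ #((perturb q.1 q.2).cliqueFinset (k + 2))
        ≤ Real.exp (-p) ^ #((perturb q.1 q.2).cliqueFinset (k + 2)) :=
          pow_le_pow_left₀ (by linarith) (by linarith [Real.add_one_le_exp (-p)]) _
      _ = Real.exp (#((perturb q.1 q.2).cliqueFinset (k + 2)) * -p) := (Real.exp_nat_mul _ _).symm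
      _ ≤ Real.exp (-(x * K) + #q.2 * -x) := by
          refine Real.exp_le_exp.2 ?_
          have e1 := mul_le_mul_of_nonneg_left hc h0
          have e2 := mul_le_mul_of_nonneg_right hx (Nat.cast_nonneg (α := ℝ) #q.2)
          have e3 := mul_le_mul_of_nonneg_left hK' hx0
          nlinarith
      _ = _ := by rw [Real.exp_add, Real.exp_nat_mul]
  have hN : (Fintype.card (Sym2 (Fin n)) : ℝ) ≤ (n : ℝ) ^ 2 := by
    rw [Sym2.card, Fintype.card_fin]
    have : (n + 1).choose 2 ≤ n ^ 2 := by
      rw [Nat.choose_two_right, Nat.add_sub_cancel]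
      refine Nat.div_le_of_le_mul ?_
      nlinarith
    exact_mod_cast this
  calc ∑ q ∈ I, bernProb p (fun F => Disjoint F (cliqueEdges (k + 2) (perturb q.1 q.2)))
      ≤ ∑ q ∈ I, Real.exp (-(x * K)) * Real.exp (-x) ^ #q.2 := sum_le_sum hterm
    _ ≤ ∑ q : (Fin n → Fin (k + 1)) × Finset (Sym2 (Fin n)),
          Real.exp (-(x * K)) * Real.exp (-x) ^ #q.2 :=
        sum_le_sum_of_subset_of_nonneg (filter_subset _ _) fun _ _ _ => by positivity
    _ = (k + 1 : ℝ) ^ n * (Real.exp (-(x * K)) *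
          (Real.exp (-x) + 1) ^ Fintype.card (Sym2 (Fin n))) := by
        rw [Fintype.sum_prod_type]
        have := sum_pow_mul_eq_add_pow (Real.exp (-x)) 1 (univ : Finset (Sym2 (Fin n)))
        simp only [one_pow, mul_one, powerset_univ, card_univ] at this
        simp [← mul_sum, this]
    _ ≤ (k + 1 : ℝ) ^ n * (Real.exp (-(x * K)) * Real.exp 1) := by
        gcongr
        calc (Real.exp (-x) + 1) ^ Fintype.card (Sym2 (Fin n))
            ≤ Real.exp (Real.exp (-x)) ^ Fintype.card (Sym2 (Fin n)) :=
              pow_le_pow_left₀ (by positivity) (Real.add_one_le_exp _) _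
          _ = Real.exp (Fintype.card (Sym2 (Fin n)) * Real.exp (-x)) := (Real.exp_nat_mul _ _).symm
          _ ≤ Real.exp 1 := by
              refine Real.exp_le_exp.2 (le_trans ?_ hxn)
              gcongr
    _ = _ := by rw [← Real.exp_add]; ring_nf

lemma one_sub_probTurannical (r n : ℕ) (p : unitInterval) :
    1 - probTurannical r n p = bernProb (p : ℝ)
      fun F : Finset {e : Finset (Fin n) // e.card = r} =>
        ¬ IsTurannical (F : UniformHypergraph r (Fin n)) := by
  rw [probTurannical_eq, bernProb_not]

open Classical in
lemma exists_of_not_isTurannical {n r : ℕ} {F : Finset {e : Finset (Fin n) // e.card = r}}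
    (h : ¬ IsTurannical (F : UniformHypergraph r (Fin n))) :
    ∃ G : SimpleGraph (Fin n), turanNumber r n < #G.edgeFinset ∧
      ¬ Detects (F : UniformHypergraph r (Fin n)) G := by
  simp only [IsTurannical, Fintype.card_fin, not_forall] at h
  obtain ⟨G, hG, hF⟩ := h
  refine ⟨G, ?_, hF⟩
  rwa [← Set.ncard_coe_finset, SimpleGraph.coe_edgeFinset]

open Classical in
lemma symmDiff_nonempty {n : ℕ} {α : Type*} {G : SimpleGraph (Fin n)} {χ : Fin n → α}
    {u v : Fin n} (h : G.Adj u v) (hχ : χ u = χ v) :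
    1 ≤ #(symmDiff G.edgeFinset (multipartite χ).edgeFinset) := by
  rw [Nat.one_le_iff_ne_zero, ← Nat.pos_iff_ne_zero, card_pos]
  exact ⟨s(u, v), Finset.mem_symmDiff.2 (Or.inl (by simp [h, hχ]))⟩

lemma eventually_sq_mul_exp_le {b : ℝ} (hb : 0 < b) :
    ∀ᶠ n : ℕ in atTop, (n : ℝ) ^ 2 * Real.exp (-(b * n)) ≤ 1 := by
  have h := (Real.tendsto_pow_mul_exp_neg_atTop_nhds_zero 2).comp
    (tendsto_natCast_atTop_atTop.const_mul_atTop hb)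
  filter_upwards [h.eventually (gt_mem_nhds (show (0 : ℝ) < b ^ 2 by positivity))] with n hn
  simp only [Function.comp] at hn
  rw [mul_pow, mul_assoc] at hn
  have : 0 < b ^ 2 := by positivity
  nlinarith

lemma tendsto_probTurannical_one_of_le {r : ℕ} {p : ℕ → unitInterval} {f : ℕ → ℝ}
    (hf : Tendsto f atTop (𝓝 0)) (h : ∀ᶠ n in atTop, 1 - probTurannical r n (p n) ≤ f n) :
    Tendsto (fun n => probTurannical r n (p n)) atTop (𝓝 1) := by
  have h1 : Tendsto (fun n => 1 - probTurannical r n (p n)) atTop (𝓝 0) := by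
    refine tendsto_of_tendsto_of_tendsto_of_le_of_le' tendsto_const_nhds hf
      (Eventually.of_forall fun n => ?_) h
    rw [one_sub_probTurannical]
    exact bernProb_nonneg (p n).2.1 (p n).2.2 _
  have h2 := h1.const_sub 1
  simpa using h2

lemma tendsto_exp_one_sub : Tendsto (fun n : ℕ => Real.exp (1 - n)) atTop (𝓝 0) := by
  refine Real.tendsto_exp_atBot.comp ?_
  simp_rw [sub_eq_add_neg]
  exact tendsto_atBot_add_const_left _ _
    (tendsto_neg_atTop_atBot.comp tendsto_natCast_atTop_atTop)

theorem exists_tendsto_probTurannical_one (k : ℕ) : ∃ C : ℝ, 0 < C ∧ ∀ p : ℕ → unitInterval,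
    (∀ᶠ n : ℕ in atTop, C * n ≤ (p n : ℝ) * (n : ℝ) ^ k) →
      Tendsto (fun n : ℕ => probTurannical (k + 2) n (p n)) atTop (𝓝 1) := by
  classical
  obtain ⟨c, hc, H⟩ := exists_multipartite_card_symmDiff_le k
  -- The logarithm absorbs the `(k + 1) ^ n` colourings; the extra `1` leaves `exp (1 - n)`. Here `K
  -- = 1` suffices, as a monochromatic edge is an edit.
  set b := Real.log (k + 1) + 1 with hb
  have hb0 : 0 < b := by
    have := Real.log_nonneg (show (1 : ℝ) ≤ k + 1 by linarith [Nat.cast_nonneg (α := ℝ) k])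
    linarith
  refine ⟨2 * b / c, by positivity, fun p hp => ?_⟩
  refine tendsto_probTurannical_one_of_le tendsto_exp_one_sub ?_
  filter_upwards [hp, eventually_sq_mul_exp_le hb0, eventually_ge_atTop 1] with n hpn hn hn1
  rw [one_sub_probTurannical]
  have hx : 2 * (b * n) ≤ p n * (c * (n : ℝ) ^ k) := by
    rw [div_mul_eq_mul_div, div_le_iff₀ hc] at hpn
    linarith
  refine (bernProb_mono (p n).2.1 (p n).2.2 fun F hF => ?_).trans
    ((bernProb_exists_not_detects_le (K := 1) hn1 (p n).2.1 (p n).2.2 (by positivity) hx hn).trans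
      (le_of_eq ?_))
  · obtain ⟨G, hG, hGF⟩ := exists_of_not_isTurannical hF
    obtain ⟨χ, ⟨u, v, huv, hχ⟩, hle⟩ := H n G hG
    exact ⟨G, χ, hle, symmDiff_nonempty huv hχ, hGF⟩
  · have e : (k + 1 : ℝ) ^ n = Real.exp (n * Real.log (k + 1)) := by
      rw [Real.exp_nat_mul, Real.exp_log (by positivity)]
    rw [e, ← Real.exp_add]
    congr 1; rw [hb]; push_cast; ring

/-! ### The 1-statement for triples above one half -/

/-- The lower tail for the number of hyperedges containing a fixed pair. -/
lemma exists_card_pairLink_tail {p : ℝ} (hp : 1 / 2 < p) (hp1 : p ≤ 1) : ∃ g b : ℝ, 0 < g ∧ 0 < b ∧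
    ∀ (n : ℕ) (u v : Fin n), u ≠ v →
      bernProb p (fun F : Finset {e : Finset (Fin n) // e.card = 3} =>
        (#(F ∩ pairLink 3 u v) : ℝ) ≤ (1 / 2 + g) * n) ≤ Real.exp (2 - b * n) := by
  set h := p - 1 / 2 with hh
  have hh0 : 0 < h := by linarith
  have hh1 : h ≤ 1 / 2 := by linarith
  refine ⟨h / 4, h / 4 * (h / 2), by positivity, by positivity, fun n u v huv => ?_⟩
  set d := h / 4 with hd
  have hd0 : 0 < d := by positivity
  set l := Real.exp (-d) with hl
  have hl0 : 0 < l := Real.exp_pos _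
  have hl1 : l ≤ 1 := Real.exp_le_one_iff.2 (by linarith)
  have hld : l ≤ 1 - d + d ^ 2 := by
    rw [hl, Real.exp_neg, inv_le_iff_one_le_mul₀ (Real.exp_pos d)]
    have := Real.add_one_le_exp d
    have h2 : 0 ≤ 1 - d + d ^ 2 := by nlinarith [sq_nonneg (d - 1)]
    nlinarith [mul_le_mul_of_nonneg_left this h2, pow_pos hd0 3]
  set a := ⌊(1 / 2 + d) * (n : ℝ)⌋₊ with ha
  have ha' : (a : ℝ) ≤ (1 / 2 + d) * n := Nat.floor_le (by positivity)
  have h0 : 0 ≤ p := by linarith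
  have htail := bernProb_card_inter_le h0 hp1 hl0.le hl1 (pairLink 3 u v) a
  refine (bernProb_mono h0 hp1 (Q := fun F => #(F ∩ pairLink 3 u v) ≤ a)
    fun F hF => Nat.le_floor hF).trans ?_
  have hla : l ^ a = Real.exp (-(a * d)) := by
    rw [hl, ← Real.exp_nat_mul]; ring_nf
  have hn2 : 2 ≤ n := by
    have := u.2; have := v.2; have : (u : ℕ) ≠ v := fun e => huv (Fin.ext e); omega
  have hcard : (#(pairLink 3 u v) : ℝ) = n - 2 := by
    rw [card_pairLink 1 huv, Nat.choose_one_right]; push_cast [hn2]; ring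
  have hup : (1 - p + p * l) ^ #(pairLink 3 u v) ≤ Real.exp (-((n - 2) * (p * (d - d ^ 2)))) := by
    calc (1 - p + p * l) ^ #(pairLink 3 u v)
        ≤ Real.exp (-(p * (d - d ^ 2))) ^ #(pairLink 3 u v) := by
          refine pow_le_pow_left₀ (by nlinarith) ?_ _
          have := Real.add_one_le_exp (-(p * (d - d ^ 2)))
          nlinarith
      _ = _ := by rw [← Real.exp_nat_mul, hcard]; ring_nf
  have h3 := htail.trans hup
  rw [hla, Real.exp_neg, inv_mul_le_iff₀ (Real.exp_pos _), ← Real.exp_add] at h3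
  refine h3.trans (Real.exp_le_exp.2 ?_)
  have e1 : (a : ℝ) * d ≤ (1 / 2 + d) * n * d := mul_le_mul_of_nonneg_right ha' hd0.le
  have hd1 : d ≤ 1 / 8 := by linarith
  have e2 : p * (d - d ^ 2) * 2 ≤ 2 := by nlinarith
  -- Since `p = 1/2 + 4d`, the first-order gain `4d²` outweighs the two error terms of at most `d²`
  -- each.
  have e3 : (1 / 2 + d) * d - p * (d - d ^ 2) ≤ -(d * (h / 2)) := by
    have : p * d ^ 2 ≤ d ^ 2 := by nlinarith [sq_nonneg d]
    have hp' : p = 1 / 2 + 4 * d := by rw [hd, hh]; ring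
    have hh' : h = 4 * d := by rw [hd]; ring
    rw [hh']; nlinarith
  have e4 := mul_le_mul_of_nonneg_right e3 (Nat.cast_nonneg (α := ℝ) n)
  nlinarith

open Classical in
lemma card_edgeFinset_multipartite_le_mul {n : ℕ} (χ : Fin n → Fin 2) (u : Fin n) :
    #(multipartite χ).edgeFinset ≤
      #(univ.filter fun x => χ x = χ u) * (n - #(univ.filter fun x => χ x = χ u)) := by
  set A := univ.filter fun x => χ x = χ u with hA
  have hAc : #Aᶜ = n - #A := by rw [card_compl, Fintype.card_fin]
  rw [← hAc, ← card_product]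
  refine (card_le_card (t := (A ×ˢ Aᶜ).image fun q => s(q.1, q.2)) ?_).trans card_image_le
  intro e
  induction e using Sym2.ind with
  | _ x y =>
    intro he
    rw [SimpleGraph.mem_edgeFinset, SimpleGraph.mem_edgeSet, multipartite_adj] at he
    rw [mem_image]
    by_cases hx : χ x = χ u
    · refine ⟨(x, y), ?_, rfl⟩
      simp only [mem_product, mem_compl, hA, mem_filter, mem_univ, true_and]
      exact ⟨hx, fun hy => he (hx.trans hy.symm)⟩
    · refine ⟨(y, x), ?_, Sym2.eq_swap⟩
      simp only [mem_product, mem_compl, hA, mem_filter, mem_univ, true_and]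
      exact ⟨by omega, hx⟩

lemma sq_le_four_mul_turanNumber (n : ℕ) : n ^ 2 ≤ 4 * turanNumber 3 n + 1 := by
  classical
  have h := SimpleGraph.card_edgeFinset_turanGraph (n := n) (r := 2)
  have h' : turanNumber 3 n = (n ^ 2 - (n % 2) ^ 2) * (2 - 1) / (2 * 2) + (n % 2).choose 2 := by
    rw [turanNumber_eq, ← h]
  rw [h']
  obtain ⟨m, rfl | rfl⟩ := Nat.even_or_odd' n
  · have : (2 * m) % 2 = 0 := by omega
    rw [this]; ring_nf; omega
  · have : (2 * m + 1) % 2 = 1 := by omega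
    rw [this]
    have : (2 * m + 1) ^ 2 - 1 ^ 2 = 4 * (m ^ 2 + m) := by
      rw [Nat.sub_eq_iff_eq_add (Nat.pow_le_pow_left (by omega) 2)]; ring
    rw [this]
    simp only [Nat.add_one_sub_one, mul_one, Nat.reduceMul]
    rw [Nat.mul_div_cancel_left _ (by norm_num)]
    nlinarith

open Classical in
/-- If all pairs lie in more than `(1 / 2 + g) n` hyperedges, then every graph with more than
`t_3(n)` edges that is within constant distance of a complete bipartite graph is detected. -/
lemma detects_of_card_pairLink {n K : ℕ} {g : ℝ} (hg : 0 < g)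
    (hn1 : 4 * K + 1 < (g * n) ^ 2) (hn2 : 4 * K ≤ g * n)
    {F : Finset {e : Finset (Fin n) // e.card = 3}}
    (hF : ∀ u v : Fin n, u ≠ v → (1 / 2 + g) * n < (#(F ∩ pairLink 3 u v) : ℝ))
    {G : SimpleGraph (Fin n)} (hG : turanNumber 3 n < #G.edgeFinset) {χ : Fin n → Fin 2}
    {u v : Fin n} (huv : G.Adj u v) (hχ : χ u = χ v)
    (hK : #(symmDiff G.edgeFinset (multipartite χ).edgeFinset) ≤ K) :
    Detects (F : UniformHypergraph 3 (Fin n)) G := by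
  by_contra hdet
  set S := symmDiff G.edgeFinset (multipartite χ).edgeFinset with hS
  set A := univ.filter fun x => χ x = χ u with hA
  have hAn : #A ≤ n := (card_le_univ A).trans_eq (Fintype.card_fin n)
  have hGT : #G.edgeFinset ≤ #A * (n - #A) + K := by
    have h1 : G.edgeFinset ⊆ (multipartite χ).edgeFinset ∪ S := by
      intro e he
      by_cases h : e ∈ (multipartite χ).edgeFinset
      · exact mem_union_left _ h
      · exact mem_union_right _ (Finset.mem_symmDiff.2 (Or.inl ⟨he, h⟩))
    have h2 := (card_le_card h1).trans (card_union_le _ _)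
    have h3 := card_edgeFinset_multipartite_le_mul χ u
    rw [← hA] at h3
    omega
  -- A larger `A` would give `4 * #A * (n - #A) ≤ n² - (gn)²`, too few edges even after `K` edits.
  have hA2 : (#A : ℝ) < (1 / 2 + g / 2) * n := by
    have h1 := sq_le_four_mul_turanNumber n
    have h2 : n ^ 2 ≤ 4 * (#A * (n - #A) + K) + 1 := by omega
    have h3 : (n : ℝ) ^ 2 ≤ 4 * (#A * (n - #A) + K) + 1 := by
      have : ((n ^ 2 : ℕ) : ℝ) ≤ ((4 * (#A * (n - #A) + K) + 1 : ℕ) : ℝ) := by exact_mod_cast h2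
      push_cast [hAn] at this
      exact this
    by_contra hcon
    push Not at hcon
    have : 0 ≤ g * n := by positivity
    nlinarith
  have hw : ∀ e : {e : Finset (Fin n) // e.card = 3}, ∃ w, e ∈ pairLink 3 u v →
      w ≠ u ∧ w ≠ v ∧ e.1 = {u, v, w} := by
    intro e
    by_cases he : e ∈ pairLink 3 u v
    · rw [mem_pairLink] at he
      have hsub : ({u, v} : Finset (Fin n)) ⊆ e.1 := by
        intro x hx; rcases mem_insert.1 hx with rfl | hx
        · exact he.1
        · rw [mem_singleton.1 hx]; exact he.2
      have hc : #(e.1 \ {u, v}) = 1 := by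
        rw [card_sdiff_of_subset hsub, e.2, card_pair huv.ne]
      obtain ⟨w, hw⟩ := card_eq_one.1 hc
      have hw' : w ∈ e.1 \ {u, v} := hw ▸ mem_singleton_self w
      simp only [Finset.mem_sdiff, mem_insert, mem_singleton, not_or] at hw'
      refine ⟨w, fun _ => ⟨hw'.2.1, hw'.2.2, ?_⟩⟩
      rw [← sdiff_union_of_subset hsub, hw]
      ext x; simp only [mem_union, mem_insert, mem_singleton]; tauto
    · exact ⟨u, fun h => absurd h he⟩
  choose w hw using hw
  -- A third vertex outside `A` must miss `u` or `v` in the undetected `G`, hence is an endpoint of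
  -- an edit. So `uv` lies in at most `#A + 2K` hyperedges.
  have hsub : (F ∩ pairLink 3 u v).image w ⊆ A ∪ S.biUnion fun e => e.toFinset := by
    intro x hx
    obtain ⟨e, he, rfl⟩ := mem_image.1 hx
    obtain ⟨heF, heL⟩ := mem_inter.1 he
    obtain ⟨hwu, hwv, hew⟩ := hw e heL
    by_cases hwA : χ (w e) = χ u
    · exact mem_union_left _ (by simp [hA, hwA])
    refine mem_union_right _ (mem_biUnion.2 ?_)
    have hnot : ¬ (G.Adj u (w e) ∧ G.Adj v (w e)) := fun h =>
      hdet ⟨e, heF, by rw [hew, SimpleGraph.is3Clique_triple_iff]; exact ⟨huv, h.1, h.2⟩⟩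
    have hmem : ∀ y, χ y = χ u → ¬ G.Adj y (w e) → ∃ a ∈ S, w e ∈ a.toFinset := by
      intro y hy hyw
      refine ⟨s(y, w e), Finset.mem_symmDiff.2 (Or.inr ⟨?_, ?_⟩), by simp⟩
      · rw [SimpleGraph.mem_edgeFinset, SimpleGraph.mem_edgeSet, multipartite_adj, hy]
        exact fun h => hwA h.symm
      · simpa using hyw
    rcases not_and_or.1 hnot with h | h
    · exact hmem u rfl h
    · exact hmem v hχ.symm h
  have hinj : Set.InjOn w (F ∩ pairLink 3 u v : Finset _) := by
    intro e he e' he' hee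
    rw [mem_coe] at he he'
    have h1 := (hw e (mem_inter.1 he).2).2.2
    have h2 := (hw e' (mem_inter.1 he').2).2.2
    exact Subtype.ext (by rw [h1, h2, hee])
  have hbi : #(S.biUnion fun e => e.toFinset) ≤ K * 2 := by
    refine (card_biUnion_le_card_mul S _ 2 fun e _ => ?_).trans (Nat.mul_le_mul_right 2 hK)
    rw [Sym2.card_toFinset]; split_ifs <;> omega
  have hcard : #(F ∩ pairLink 3 u v) ≤ #A + K * 2 := by
    rw [← card_image_of_injOn hinj]
    exact (card_le_card hsub).trans ((card_union_le _ _).trans (by omega))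
  have hcard' : (#(F ∩ pairLink 3 u v) : ℝ) ≤ #A + K * 2 := by exact_mod_cast hcard
  have := hF u v huv.ne
  nlinarith

theorem tendsto_probTurannical_three_one (p : unitInterval) (hp : 1 / 2 < (p : ℝ)) :
    Tendsto (fun n : ℕ => probTurannical 3 n p) atTop (𝓝 1) := by
  classical
  obtain ⟨c, hc, H⟩ := exists_multipartite_card_symmDiff_le 1
  obtain ⟨g, b, hg, hb, htail⟩ := exists_card_pairLink_tail hp p.2.2
  have hp0 : (0 : ℝ) < p := by linarith
  set y := p * c / 2 with hy
  have hy0 : 0 < y := by positivity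
  -- With `y * K ≥ 2`, the factor `exp (-y * n * K)` beats the `2 ^ n` colourings with `exp (-n)` to
  -- spare.
  obtain ⟨K, hK⟩ := exists_nat_ge (2 / y)
  have hK' : 2 ≤ y * K := by rwa [div_le_iff₀' hy0] at hK
  have hf : Tendsto (fun n : ℕ => Real.exp (1 - n) + (n : ℝ) ^ 2 * Real.exp (2 - b * n)) atTop
      (𝓝 0) := by
    rw [← add_zero (0 : ℝ)]
    refine tendsto_exp_one_sub.add ?_
    have h := ((Real.tendsto_pow_mul_exp_neg_atTop_nhds_zero 2).comp
      (tendsto_natCast_atTop_atTop.const_mul_atTop hb)).const_mul (Real.exp 2 / b ^ 2)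
    rw [mul_zero] at h
    refine h.congr fun n => ?_
    simp only [Function.comp]
    rw [Real.exp_sub, Real.exp_neg]
    field_simp
  refine tendsto_probTurannical_one_of_le hf ?_
  have hgn : Tendsto (fun n : ℕ => g * (n : ℝ)) atTop atTop :=
    tendsto_natCast_atTop_atTop.const_mul_atTop hg
  filter_upwards [eventually_sq_mul_exp_le hy0, eventually_ge_atTop 1,
    hgn.eventually_ge_atTop (4 * K + 2)] with n hn hn1 hgn
  have hpl : (4 * K + 1 : ℝ) < (g * n) ^ 2 := by nlinarith [Nat.cast_nonneg (α := ℝ) K]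
  rw [one_sub_probTurannical]
  have hx : 2 * (y * n) ≤ p * (c * (n : ℝ) ^ 1) := by rw [hy]; apply le_of_eq; ring
  have hunion := bernProb_exists_not_detects_le (k := 1) (K := K) hn1 p.2.1 p.2.2
    (by positivity) hx hn
  have hpairs := (bernProb_exists_le p.2.1 p.2.2 (univ.filter fun q : Fin n × Fin n => q.1 ≠ q.2)
    (fun q (F : Finset {e : Finset (Fin n) // e.card = 3}) =>
      (#(F ∩ pairLink 3 q.1 q.2) : ℝ) ≤ (1 / 2 + g) * n)).trans
    (sum_le_card_nsmul _ _ _ fun q hq => htail n q.1 q.2 (mem_filter.1 hq).2)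
  refine (bernProb_mono p.2.1 p.2.2 fun F hF => ?_).trans
    ((bernProb_or_le p.2.1 p.2.2 _ _).trans (add_le_add (hunion.trans ?_) (hpairs.trans ?_)))
  · obtain ⟨G, hG, hGF⟩ := exists_of_not_isTurannical hF
    obtain ⟨χ, ⟨u, v, huv, hχ⟩, hle⟩ := H n G hG
    rcases le_total K #(symmDiff G.edgeFinset (multipartite χ).edgeFinset) with hKS | hKS
    · exact Or.inl ⟨G, χ, hle, hKS, hGF⟩
    · right
      by_contra hcon
      refine hGF (detects_of_card_pairLink hg hpl (by linarith) (fun u v huv => ?_) hG huv hχ hKS)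
      by_contra hle
      exact hcon ⟨(u, v), by simp [huv], not_lt.1 hle⟩
  · have h2 : ((1 : ℕ) + 1 : ℝ) ≤ Real.exp 1 := by
      have := Real.add_one_le_exp (1 : ℝ); push_cast; exact this
    calc ((1 : ℕ) + 1 : ℝ) ^ n * Real.exp (1 - y * n * K)
        ≤ Real.exp 1 ^ n * Real.exp (1 - y * n * K) := by gcongr
      _ = Real.exp (n + (1 - y * n * K)) := by rw [← Real.exp_nat_mul, ← Real.exp_add, mul_one]
      _ ≤ _ := by
        refine Real.exp_le_exp.2 ?_
        nlinarith [Nat.cast_nonneg (α := ℝ) n]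
  · rw [nsmul_eq_mul]
    gcongr
    have : #(univ.filter fun q : Fin n × Fin n => q.1 ≠ q.2) ≤ n ^ 2 := by
      refine (card_filter_le _ _).trans_eq ?_
      rw [card_univ, Fintype.card_prod, Fintype.card_fin, sq]
    exact_mod_cast this

/-- Converts the threshold `n^(3-r)` for `p` into a linear threshold for `p * n ^ k`, where `r = k +
2`. -/
lemma zpow_three_sub_mul {n k : ℕ} (hn : 1 ≤ n) :
    (n : ℝ) ^ (3 - ((k + 2 : ℕ) : ℤ)) * (n : ℝ) ^ k = n := by
  have hn0 : (n : ℝ) ≠ 0 := by positivity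
  rw [← zpow_natCast, ← zpow_add₀ hn0]
  have : 3 - ((k + 2 : ℕ) : ℤ) + (k : ℤ) = 1 := by push_cast; ring
  rw [this, zpow_one]

end Turannical

theorem mainTheorem1 :
    (∀ p : unitInterval,
      ((p : ℝ) ≤ 1 / 2 →
        Tendsto (fun n : ℕ => Turannical.probTurannical 3 n p) atTop (𝓝 0)) ∧
      ((1 / 2 : ℝ) < (p : ℝ) →
        Tendsto (fun n : ℕ => Turannical.probTurannical 3 n p) atTop (𝓝 1))) ∧
    (∀ r : ℕ, 3 < r → ∃ c C : ℝ, 0 < c ∧ 0 < C ∧ ∀ p : ℕ → unitInterval,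
      ((∀ᶠ n : ℕ in atTop, (p n : ℝ) ≤ c * (n : ℝ) ^ (3 - (r : ℤ))) →
        Tendsto (fun n : ℕ => Turannical.probTurannical r n (p n)) atTop (𝓝 0)) ∧
      ((∀ᶠ n : ℕ in atTop, C * (n : ℝ) ^ (3 - (r : ℤ)) ≤ (p n : ℝ)) →
        Tendsto (fun n : ℕ => Turannical.probTurannical r n (p n)) atTop (𝓝 1))) := by
  refine ⟨fun p => ⟨Turannical.tendsto_probTurannical_three_zero p,
    Turannical.tendsto_probTurannical_three_one p⟩, fun r hr => ?_⟩
  obtain ⟨k, rfl⟩ : ∃ k, r = k + 2 := ⟨r - 2, by omega⟩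
  obtain ⟨C, hC, H⟩ := Turannical.exists_tendsto_probTurannical_one k
  refine ⟨1 / (4 * (k + 1)), C, by positivity, hC, fun p => ⟨fun hp => ?_, fun hp => H p ?_⟩⟩
  · refine Turannical.tendsto_probTurannical_zero k (by omega) p ?_
    filter_upwards [hp, eventually_ge_atTop 1] with n h hn
    have := mul_le_mul_of_nonneg_right h (show (0 : ℝ) ≤ (n : ℝ) ^ k by positivity)
    rw [mul_assoc, Turannical.zpow_three_sub_mul hn] at this
    linarith [one_div_mul_eq_div (4 * ((k : ℝ) + 1)) (n : ℝ)]
  · filter_upwards [hp, eventually_ge_atTop 1] with n h hn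
    have := mul_le_mul_of_nonneg_right h (show (0 : ℝ) ≤ (n : ℝ) ^ k by positivity)
    rwa [mul_assoc, Turannical.zpow_three_sub_mul hn] at this
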